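/- Let $M\ge 1$, $H>0$, $h=H/M$. A multirate tableau consists of $A^{ss}$, $b^{s}$ and, for each $\lambda=1,\dots,M$, of $A^{sf,\lambda},A^{fs,\lambda},A^{ff,\lambda},b^{f,\lambda}$ (real matrices and vectors of compatible, arbitrary sizes; $\mathbf 1$ is the all-ones vector). **MGARK schemes.** An MGARK scheme (one multirate tableau with square diagonal blocks) for $y'=f^{s}(y)+f^{f}(y)$ is $$y_1=y_0+h\sum_{\lambda,i}b^{f,\lambda}_i f^f(Y^{f,\lambda}_i)+H\sum_i b^s_i f^s(Y^s_i),\qquad Y^s_i=y_0+H\sum_j a^{ss}_{ij}f^s(Y^s_j)+h\sum_{\lambda,j}a^{sf,\lambda}_{ij}f^f(Y^{f,\lambda}_j),$$ $$Y^{f,\lambda}_i=y_0+h\sum_{\ell<\lambda}\sum_j b^{f,\ell}_jf^f(Y^{f,\ell}_j)+H\sum_j a^{fs,\lambda}_{ij}f^s(Y^s_j)+h\sum_j a^{ff,\lambda}_{ij}f^f(Y^{f,\lambda}_j).$$ It has order $p$ if, for all $d$, all $C^\infty$ maps $f^s,f^f:\mathbb R^d\to\mathbb R^d$ and every exact solution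 $y$ near $t=0$ with $y(0)=y_0$, the step with stages tending to $y_0$ as $H\to0^+$ satisfies $y_1-y(H)=O(H^{p+1})$. **Partitioned MGARK schemes.** A partitioned MGARK scheme has two multirate tableaux $(\bar A,\bar b)$, $(\tilde A,\tilde b)$, where the rows of $\bar A$ (and the columns of $\tilde A$, and $\tilde b$) are indexed by the $Q$-stages and the rows of $\tilde A$ (and the columns of $\bar A$, and $\bar b$) by the $P$-stages. It is applied to $p'=-\nabla V^s(q)-\nabla V^f(q)$, $q'=\nabla T^s(p)+\nabla T^f(p)$, with $C^\infty$ functions $V^s,V^f,T^s,T^f$ on $\mathbb R^d$: $q_1$ and the $Q$-stages are formed as above from $q_0$, the slopes $\nabla T(P)$ and $(\bar A,\bar b)$; $p_1$ and the $P$-stages from $p_0$, the slopes $-\nabla V(Q)$ and $(\tilde A,\tilde b)$. Order $p$ is defined in the same way, for both components $p$ and $q$. **Conditions.** Let $(B,\beta)$, $(C,\gamma)$ stand for $(\bar A,\bar b),(\tilde A,\tilde b)$ and also for $(\tilde A,\tilde b),(\bar A,\bar b)$ (partitioned schemes), and both for $(A,b)$ (MGARK schemes). Put $\sigma^B_\lambda=\sum_{\ell<\lambda}\beta^{f,\ell\top}\mathbf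 1$, $\tau^B_\lambda=\sum_{\mu>\lambda}\beta^{f,\mu\top}\mathbf 1$, $\sigma^C_\lambda=\sum_{\ell<\lambda}\gamma^{f,\ell\top}\mathbf 1$, $u_\lambda=B^{ff,\lambda}\mathbf 1+\sigma^B_\lambda\mathbf 1$, $v_\lambda=C^{ff,\lambda}\mathbf 1+\sigma^C_\lambda\mathbf 1$. All sums run over $1,\dots,M$. Order one: $\beta^{s\top}\mathbf 1=1$; $\sum_\lambda\beta^{f,\lambda\top}\mathbf 1=M$. Order two, slow: $\beta^{s\top}C^{ss}\mathbf 1=\frac12$; $\beta^{s\top}\sum_\lambda C^{sf,\lambda}\mathbf 1=\frac M2$. Order two, fast: $\sum_\lambda\beta^{f,\lambda\top}v_\lambda=\frac{M^2}2$; $\sum_\lambda\beta^{f,\lambda\top}C^{fs,\lambda}\mathbf 1=\frac M2$. Order three, slow: $\beta^{s\top}\mathrm{diag}(C^{ss}\mathbf 1)C^{ss}\mathbf 1=\frac13$; $\beta^{s\top}\mathrm{diag}(C^{ss}\mathbf 1)\sum_\lambda C^{sf,\lambda}\mathbf 1=\frac M3$; $\beta^{s\top}\mathrm{diag}(\sum_\lambda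 C^{sf,\lambda}\mathbf 1)\sum_\lambda C^{sf,\lambda}\mathbf 1=\frac{M^2}3$; $\beta^{s\top}C^{ss}B^{ss}\mathbf 1=\frac16$; $\beta^{s\top}C^{ss}\sum_\lambda B^{sf,\lambda}\mathbf 1=\frac M6$; $\beta^{s\top}\sum_\lambda C^{sf,\lambda}B^{fs,\lambda}\mathbf 1=\frac M6$; $\beta^{s\top}\sum_\lambda C^{sf,\lambda}u_\lambda=\frac{M^2}6$. Order three, fast: $\sum_\lambda\beta^{f,\lambda\top}\mathrm{diag}(v_\lambda)v_\lambda=\frac{M^3}3$; $\sum_\lambda\beta^{f,\lambda\top}\mathrm{diag}(v_\lambda)C^{fs,\lambda}\mathbf 1=\frac{M^2}3$; $\sum_\lambda\beta^{f,\lambda\top}\mathrm{diag}(C^{fs,\lambda}\mathbf 1)C^{fs,\lambda}\mathbf 1=\frac M3$; $\sum_\lambda(\beta^{f,\lambda\top}C^{ff,\lambda}+\tau^B_\lambda\gamma^{f,\lambda\top})u_\lambda=\frac{M^3}6$; $\sum_\lambda(\beta^{f,\lambda\top}C^{ff,\lambda}+\tau^B_\lambda\gamma^{f,\lambda\top})B^{fs,\lambda}\mathbf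 1=\frac{M^2}6$; $\sum_\lambda\beta^{f,\lambda\top}C^{fs,\lambda}\sum_\mu B^{sf,\mu}\mathbf 1=\frac{M^2}6$; $\sum_\lambda\beta^{f,\lambda\top}C^{fs,\lambda}B^{ss}\mathbf 1=\frac M6$. **Theorem.** The following hold for every MGARK scheme and for every partitioned MGARK scheme. 1. For $p=1,2,3$ the scheme has order $p$ if and only if the conditions of all orders $\le p$ hold. 2. Suppose that, for each tableau, $\beta^{f,\lambda\top}\mathbf 1$ does not depend on $\lambda$. Then the scheme has order two if and only if the conditions of order one and two hold, where the first fast condition of order two is replaced by $\sum_\lambda\beta^{f,\lambda\top}C^{ff,\lambda}\mathbf 1=\frac M2$. If moreover $\beta^{f,\lambda\top}C^{ff,\lambda}\mathbf 1$ does not depend on $\lambda$ (e.g. if all micro-steps use the same $A^{ff},b^f$), then the scheme has order three if and only if the order-one conditions, these order-two conditions and the order-three conditions hold, where in the latter $u_\lambda$ in the last slow condition is replaced by $B^{ff,\lambda}\mathbf 1+(\lambda-1)\mathbf 1$, $v_\lambda$ in the second fast condition by $C^{ff,\lambda}\mathbf 1+(\lambda-1)\mathbf 1$, and the first and the fourth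 fast condition by $\sum_\lambda\beta^{f,\lambda\top}\mathrm{diag}(C^{ff,\lambda}\mathbf 1)C^{ff,\lambda}\mathbf 1=\frac M3$ and $\sum_\lambda\beta^{f,\lambda\top}C^{ff,\lambda}B^{ff,\lambda}\mathbf 1=\frac M6$. 3. Call a tableau symmetric if its stage numbers agree in micro-steps $\lambda$ and $M+1-\lambda$ and, with $P$ the reversal of the order of the entries, $Pb^s=b^s$, $Pb^{f,M+1-\lambda}=b^{f,\lambda}$, $A^{ss}+PA^{ss}P=\mathbf 1b^{s\top}$, $A^{sf,\lambda}+PA^{sf,M+1-\lambda}P=\mathbf 1b^{f,\lambda\top}$, $A^{fs,\lambda}+PA^{fs,M+1-\lambda}P=\mathbf 1b^{s\top}$, $A^{ff,\lambda}+PA^{ff,M+1-\lambda}P=\mathbf 1b^{f,\lambda\top}$; a partitioned scheme is symmetric if both tableaux are. If a symmetric scheme satisfies the order-one conditions, then it satisfies the order-two conditions (also in the form of 2 if $\beta^{f,\lambda\top}\mathbf 1$ does not depend on $\lambda$, for each tableau). -/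

import Mathlib

open Filter Topology Asymptotics
open scoped ContDiff Matrix

/-- The coefficients of a multirate GARK tableau with `M` micro-steps,

`[ (1/M) A^{ff,1}                                      | A^{fs,1} ]`
`[ (1/M) 1 b^{f,1}ᵀ   (1/M) A^{ff,2}                   | A^{fs,2} ]`
`[   ...                             ...               |   ...    ]`
`[ (1/M) 1 b^{f,1}ᵀ   ...            (1/M) A^{ff,M}    | A^{fs,M} ]`
`[ (1/M) A^{sf,1}     ...            (1/M) A^{sf,M}    | A^{ss}   ]`
`[ (1/M) b^{f,1}ᵀ     ...            (1/M) b^{f,M}ᵀ    | b^{s}ᵀ   ]`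

The rows are the stages that are computed: `rS` slow ones and `rF k` fast ones in micro-step `k`.
The columns are the stages at which the right-hand sides are evaluated: `cS` slow ones and `cF k`
fast ones in micro-step `k`. Micro-steps are numbered from `0`, so the `k` here is `λ - 1`. -/
structure MRTableau (M rS cS : ℕ) (rF cF : Fin M → ℕ) where
  Ass : Matrix (Fin rS) (Fin cS) ℝ
  Asf : ∀ k, Matrix (Fin rS) (Fin (cF k)) ℝ
  Afs : ∀ k, Matrix (Fin (rF k)) (Fin cS) ℝ
  Aff : ∀ k, Matrix (Fin (rF k)) (Fin (cF k)) ℝ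
  bs : Fin cS → ℝ
  bf : ∀ k, Fin (cF k) → ℝ

namespace MRTableau

noncomputable section

section Increments

variable {M rS cS : ℕ} {rF cF : Fin M → ℕ} {E : Type*} [AddCommGroup E] [Module ℝ E]

/-- Increment of the slow stage `i`, from the slow slopes `FS` and the fast slopes `FF`, with
macro-step `H` and micro-step `H / M`. -/
def slowIncr (B : MRTableau M rS cS rF cF) (H : ℝ) (FS : Fin cS → E) (FF : ∀ k, Fin (cF k) → E)
    (i : Fin rS) : E :=
  H • ∑ j, B.Ass i j • FS j + (H / M) • ∑ k, ∑ j, B.Asf k i j • FF k j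

/-- Increment of the fast stage `i` of micro-step `k`. -/
def fastIncr (B : MRTableau M rS cS rF cF) (H : ℝ) (FS : Fin cS → E) (FF : ∀ k, Fin (cF k) → E)
    (k : Fin M) (i : Fin (rF k)) : E :=
  (H / M) • ∑ l ∈ Finset.Iio k, ∑ j, B.bf l j • FF l j + H • ∑ j, B.Afs k i j • FS j
    + (H / M) • ∑ j, B.Aff k i j • FF k j

/-- Increment of the solution over one macro-step. -/
def stepIncr (B : MRTableau M rS cS rF cF) (H : ℝ) (FS : Fin cS → E) (FF : ∀ k, Fin (cF k) → E) :
    E :=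
  (H / M) • ∑ k, ∑ j, B.bf k j • FF k j + H • ∑ j, B.bs j • FS j

end Increments

section Conditions

variable {M rS cS : ℕ} {rF cF : Fin M → ℕ}

/-- The sum of the weights in micro-step `k`. -/
def wt (B : MRTableau M rS cS rF cF) (k : Fin M) : ℝ := B.bf k ⬝ᵥ 1

/-- The sum of the weights in all micro-steps before `k`. -/
def wtBefore (B : MRTableau M rS cS rF cF) (k : Fin M) : ℝ := ∑ l ∈ Finset.Iio k, B.wt l

/-- The sum of the weights in all micro-steps after `k`. -/
def wtAfter (B : MRTableau M rS cS rF cF) (k : Fin M) : ℝ := ∑ l ∈ Finset.Ioi k, B.wt l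

/-- Order-one conditions. -/
structure OrderOne (B : MRTableau M rS cS rF cF) : Prop where
  slow : B.bs ⬝ᵥ 1 = 1
  fast : ∑ k, B.bf k ⬝ᵥ 1 = M

/-! Below, `B` is the tableau whose weights stand at the root, and `C` the tableau of the stages
at which the right-hand sides belonging to these weights are evaluated. For an ordinary scheme
`C = B`; for a partitioned scheme `B` and `C` are its two tableaux. -/

/-- Order-two conditions on the slow block. -/
structure SlowTwo (B : MRTableau M rS cS rF cF) (C : MRTableau M cS rS cF rF) : Prop where
  ss : B.bs ⬝ᵥ (C.Ass *ᵥ 1) = 1 / 2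
  sf : B.bs ⬝ᵥ (∑ k, C.Asf k *ᵥ 1) = M / 2

/-- Order-two conditions on the fast block. -/
structure FastTwo (B : MRTableau M rS cS rF cF) (C : MRTableau M cS rS cF rF) : Prop where
  ff : ∑ k, B.bf k ⬝ᵥ (C.Aff k *ᵥ 1 + C.wtBefore k • 1) = (M : ℝ) ^ 2 / 2
  fs : ∑ k, B.bf k ⬝ᵥ (C.Afs k *ᵥ 1) = M / 2

/-- Order-two conditions on the fast block, in the form for equal weight sums in all micro-steps. -/
structure FastTwoUniform (B : MRTableau M rS cS rF cF) (C : MRTableau M cS rS cF rF) : Prop where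
  ff : ∑ k, B.bf k ⬝ᵥ (C.Aff k *ᵥ 1) = M / 2
  fs : ∑ k, B.bf k ⬝ᵥ (C.Afs k *ᵥ 1) = M / 2

/-- Order-three conditions on the slow block. -/
structure SlowThree (B : MRTableau M rS cS rF cF) (C : MRTableau M cS rS cF rF) : Prop where
  ss_ss : B.bs ⬝ᵥ (Matrix.diagonal (C.Ass *ᵥ 1) *ᵥ (C.Ass *ᵥ 1)) = 1 / 3
  ss_sf : B.bs ⬝ᵥ (Matrix.diagonal (C.Ass *ᵥ 1) *ᵥ (∑ k, C.Asf k *ᵥ 1)) = M / 3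
  sf_sf : B.bs ⬝ᵥ (Matrix.diagonal (∑ k, C.Asf k *ᵥ 1) *ᵥ (∑ k, C.Asf k *ᵥ 1)) = (M : ℝ) ^ 2 / 3
  sss : B.bs ⬝ᵥ (C.Ass *ᵥ (B.Ass *ᵥ 1)) = 1 / 6
  ssf : B.bs ⬝ᵥ (C.Ass *ᵥ (∑ k, B.Asf k *ᵥ 1)) = M / 6
  sfs : B.bs ⬝ᵥ (∑ k, C.Asf k *ᵥ (B.Afs k *ᵥ 1)) = M / 6
  sff : B.bs ⬝ᵥ (∑ k, C.Asf k *ᵥ (B.Aff k *ᵥ 1 + B.wtBefore k • 1)) = (M : ℝ) ^ 2 / 6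

/-- Order-three conditions on the fast block. -/
structure FastThree (B : MRTableau M rS cS rF cF) (C : MRTableau M cS rS cF rF) : Prop where
  ff_ff : ∑ k, B.bf k ⬝ᵥ (Matrix.diagonal (C.Aff k *ᵥ 1 + C.wtBefore k • 1)
    *ᵥ (C.Aff k *ᵥ 1 + C.wtBefore k • 1)) = (M : ℝ) ^ 3 / 3
  ff_fs : ∑ k, B.bf k ⬝ᵥ (Matrix.diagonal (C.Aff k *ᵥ 1 + C.wtBefore k • 1)
    *ᵥ (C.Afs k *ᵥ 1)) = (M : ℝ) ^ 2 / 3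
  fs_fs : ∑ k, B.bf k ⬝ᵥ (Matrix.diagonal (C.Afs k *ᵥ 1) *ᵥ (C.Afs k *ᵥ 1)) = M / 3
  fff : ∑ k, (B.bf k ⬝ᵥ (C.Aff k *ᵥ (B.Aff k *ᵥ 1 + B.wtBefore k • 1))
    + B.wtAfter k * (C.bf k ⬝ᵥ (B.Aff k *ᵥ 1 + B.wtBefore k • 1))) = (M : ℝ) ^ 3 / 6
  ffs : ∑ k, (B.bf k ⬝ᵥ (C.Aff k *ᵥ (B.Afs k *ᵥ 1))
    + B.wtAfter k * (C.bf k ⬝ᵥ (B.Afs k *ᵥ 1))) = (M : ℝ) ^ 2 / 6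
  fsf : ∑ k, B.bf k ⬝ᵥ (C.Afs k *ᵥ (∑ l, B.Asf l *ᵥ 1)) = (M : ℝ) ^ 2 / 6
  fss : ∑ k, B.bf k ⬝ᵥ (C.Afs k *ᵥ (B.Ass *ᵥ 1)) = M / 6

/-- Order-three conditions on the slow block, in the form for uniform micro-steps. -/
structure SlowThreeUniform (B : MRTableau M rS cS rF cF) (C : MRTableau M cS rS cF rF) :
    Prop where
  ss_ss : B.bs ⬝ᵥ (Matrix.diagonal (C.Ass *ᵥ 1) *ᵥ (C.Ass *ᵥ 1)) = 1 / 3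
  ss_sf : B.bs ⬝ᵥ (Matrix.diagonal (C.Ass *ᵥ 1) *ᵥ (∑ k, C.Asf k *ᵥ 1)) = M / 3
  sf_sf : B.bs ⬝ᵥ (Matrix.diagonal (∑ k, C.Asf k *ᵥ 1) *ᵥ (∑ k, C.Asf k *ᵥ 1)) = (M : ℝ) ^ 2 / 3
  sss : B.bs ⬝ᵥ (C.Ass *ᵥ (B.Ass *ᵥ 1)) = 1 / 6
  ssf : B.bs ⬝ᵥ (C.Ass *ᵥ (∑ k, B.Asf k *ᵥ 1)) = M / 6
  sfs : B.bs ⬝ᵥ (∑ k, C.Asf k *ᵥ (B.Afs k *ᵥ 1)) = M / 6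
  sff : B.bs ⬝ᵥ (∑ k, C.Asf k *ᵥ (B.Aff k *ᵥ 1 + (k : ℝ) • 1)) = (M : ℝ) ^ 2 / 6

/-- Order-three conditions on the fast block, in the form for uniform micro-steps. -/
structure FastThreeUniform (B : MRTableau M rS cS rF cF) (C : MRTableau M cS rS cF rF) :
    Prop where
  ff_ff : ∑ k, B.bf k ⬝ᵥ (Matrix.diagonal (C.Aff k *ᵥ 1) *ᵥ (C.Aff k *ᵥ 1)) = M / 3
  ff_fs : ∑ k, B.bf k ⬝ᵥ ((Matrix.diagonal (C.Aff k *ᵥ 1) + (k : ℝ) • 1)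
    *ᵥ (C.Afs k *ᵥ 1)) = (M : ℝ) ^ 2 / 3
  fs_fs : ∑ k, B.bf k ⬝ᵥ (Matrix.diagonal (C.Afs k *ᵥ 1) *ᵥ (C.Afs k *ᵥ 1)) = M / 3
  fff : ∑ k, B.bf k ⬝ᵥ (C.Aff k *ᵥ (B.Aff k *ᵥ 1)) = M / 6
  ffs : ∑ k, (B.bf k ⬝ᵥ (C.Aff k *ᵥ (B.Afs k *ᵥ 1))
    + B.wtAfter k * (C.bf k ⬝ᵥ (B.Afs k *ᵥ 1))) = (M : ℝ) ^ 2 / 6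
  fsf : ∑ k, B.bf k ⬝ᵥ (C.Afs k *ᵥ (∑ l, B.Asf l *ᵥ 1)) = (M : ℝ) ^ 2 / 6
  fss : ∑ k, B.bf k ⬝ᵥ (C.Afs k *ᵥ (B.Ass *ᵥ 1)) = M / 6

/-- The weight sums `b^{f,k}ᵀ 1` are the same in all micro-steps. -/
def UniformWt (B : MRTableau M rS cS rF cF) : Prop :=
  ∀ k l, B.bf k ⬝ᵥ 1 = B.bf l ⬝ᵥ 1

/-- The sums `b^{f,k}ᵀ A^{ff,k} 1` are the same in all micro-steps. -/
def UniformTwo (B : MRTableau M rS cS rF cF) (C : MRTableau M cS rS cF rF) : Prop :=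
  ∀ k l, B.bf k ⬝ᵥ (C.Aff k *ᵥ 1) = B.bf l ⬝ᵥ (C.Aff l *ᵥ 1)

/-- The symmetry conditions: reversing the order of all stages (and hence of the micro-steps)
leaves the weights fixed and turns each block `A` into `1 bᵀ - A`. -/
structure IsSymmetric (B : MRTableau M rS cS rF cF) : Prop where
  rows : ∀ k : Fin M, rF k = rF k.rev
  cols : ∀ k : Fin M, cF k = cF k.rev
  bs : ∀ j, B.bs j.rev = B.bs j
  bf : ∀ k j, B.bf k.rev (Fin.cast (cols k) j.rev) = B.bf k j
  Ass : ∀ i j, B.Ass i j + B.Ass i.rev j.rev = B.bs j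
  Asf : ∀ k i j, B.Asf k i j + B.Asf k.rev i.rev (Fin.cast (cols k) j.rev) = B.bf k j
  Afs : ∀ k i j, B.Afs k i j + B.Afs k.rev (Fin.cast (rows k) i.rev) j.rev = B.bs j
  Aff : ∀ k i j, B.Aff k i j
    + B.Aff k.rev (Fin.cast (rows k) i.rev) (Fin.cast (cols k) j.rev) = B.bf k j

end Conditions

end

end MRTableau

/-- A multirate GARK scheme with `M` micro-steps, `s` slow stages and `sF k` fast stages in
micro-step `k`. -/
abbrev MGARK (M s : ℕ) (sF : Fin M → ℕ) := MRTableau M s s sF sF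

namespace MGARK

noncomputable section

variable {M s : ℕ} {sF : Fin M → ℕ}

/-- `YS`, `YF` solve the stage equations for `y' = fS y + fF y` at `y₀` with macro-step `H`. -/
def IsStages (S : MGARK M s sF) {d : ℕ}
    (fS fF : EuclideanSpace ℝ (Fin d) → EuclideanSpace ℝ (Fin d)) (H : ℝ)
    (y₀ : EuclideanSpace ℝ (Fin d)) (YS : Fin s → EuclideanSpace ℝ (Fin d))
    (YF : ∀ k, Fin (sF k) → EuclideanSpace ℝ (Fin d)) : Prop :=
  (∀ i, YS i = y₀ + S.slowIncr H (fun j => fS (YS j)) (fun k j => fF (YF k j)) i) ∧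
  (∀ k i, YF k i = y₀ + S.fastIncr H (fun j => fS (YS j)) (fun k j => fF (YF k j)) k i)

/-- The numerical solution after one macro-step, from the stages. -/
def next (S : MGARK M s sF) {d : ℕ}
    (fS fF : EuclideanSpace ℝ (Fin d) → EuclideanSpace ℝ (Fin d)) (H : ℝ)
    (y₀ : EuclideanSpace ℝ (Fin d)) (YS : Fin s → EuclideanSpace ℝ (Fin d))
    (YF : ∀ k, Fin (sF k) → EuclideanSpace ℝ (Fin d)) : EuclideanSpace ℝ (Fin d) :=
  y₀ + S.stepIncr H (fun j => fS (YS j)) (fun k j => fF (YF k j))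

/-- Order (at least) `p`: for all smooth right-hand sides, every exact solution `y` near time `0`,
and the solution of the stage equations near `y 0` for small `H > 0` (which exists and is unique by
the implicit function theorem), the local error is `O(H^(p+1))`. -/
def HasOrder (S : MGARK M s sF) (p : ℕ) : Prop :=
  ∀ (d : ℕ) (fS fF : EuclideanSpace ℝ (Fin d) → EuclideanSpace ℝ (Fin d)),
    ContDiff ℝ ∞ fS → ContDiff ℝ ∞ fF →
    ∀ y : ℝ → EuclideanSpace ℝ (Fin d),
    (∀ᶠ t in 𝓝 0, HasDerivAt y (fS (y t) + fF (y t)) t) →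
    ∀ (YS : ℝ → Fin s → EuclideanSpace ℝ (Fin d))
      (YF : ℝ → ∀ k, Fin (sF k) → EuclideanSpace ℝ (Fin d)),
    (∀ᶠ H in 𝓝[>] 0, S.IsStages fS fF H (y 0) (YS H) (YF H)) →
    (∀ i, Tendsto (fun H => YS H i) (𝓝[>] 0) (𝓝 (y 0))) →
    (∀ k i, Tendsto (fun H => YF H k i) (𝓝[>] 0) (𝓝 (y 0))) →
    (fun H => S.next fS fF H (y 0) (YS H) (YF H) - y H) =O[𝓝[>] 0] fun H => H ^ (p + 1)

end

end MGARK

/-- A partitioned multirate GARK scheme for `p' = -∇V q`, `q' = ∇T p` with `sP`, `sPF k` slow and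
fast stages for `p`, and `sQ`, `sQF k` slow and fast stages for `q`. -/
structure PMGARK (M sP sQ : ℕ) (sPF sQF : Fin M → ℕ) where
  /-- The coefficients `Ā`, `b̄`, which multiply the slopes `∇T(P)` in the equations for `q`. -/
  bar : MRTableau M sQ sP sQF sPF
  /-- The coefficients `Ã`, `b̃`, which multiply the slopes `-∇V(Q)` in the equations for `p`. -/
  til : MRTableau M sP sQ sPF sQF

namespace PMGARK

noncomputable section

variable {M sP sQ : ℕ} {sPF sQF : Fin M → ℕ}

/-- The stages `PS`, `PF`, `QS`, `QF` solve the stage equations for the Hamiltonian system of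
`TS p + TF p + VS q + VF q` at `(p₀, q₀)` with macro-step `H`. -/
def IsStages (S : PMGARK M sP sQ sPF sQF) {d : ℕ}
    (TS TF VS VF : EuclideanSpace ℝ (Fin d) → ℝ) (H : ℝ) (p₀ q₀ : EuclideanSpace ℝ (Fin d))
    (PS : Fin sP → EuclideanSpace ℝ (Fin d)) (PF : ∀ k, Fin (sPF k) → EuclideanSpace ℝ (Fin d))
    (QS : Fin sQ → EuclideanSpace ℝ (Fin d)) (QF : ∀ k, Fin (sQF k) → EuclideanSpace ℝ (Fin d)) :
    Prop :=
  (∀ i, PS i = p₀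
    + S.til.slowIncr H (fun j => -gradient VS (QS j)) (fun k j => -gradient VF (QF k j)) i) ∧
  (∀ k i, PF k i = p₀
    + S.til.fastIncr H (fun j => -gradient VS (QS j)) (fun k j => -gradient VF (QF k j)) k i) ∧
  (∀ i, QS i = q₀
    + S.bar.slowIncr H (fun j => gradient TS (PS j)) (fun k j => gradient TF (PF k j)) i) ∧
  (∀ k i, QF k i = q₀
    + S.bar.fastIncr H (fun j => gradient TS (PS j)) (fun k j => gradient TF (PF k j)) k i)

/-- The momenta after one macro-step. -/
def nextP (S : PMGARK M sP sQ sPF sQF) {d : ℕ}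
    (VS VF : EuclideanSpace ℝ (Fin d) → ℝ) (H : ℝ) (p₀ : EuclideanSpace ℝ (Fin d))
    (QS : Fin sQ → EuclideanSpace ℝ (Fin d)) (QF : ∀ k, Fin (sQF k) → EuclideanSpace ℝ (Fin d)) :
    EuclideanSpace ℝ (Fin d) :=
  p₀ + S.til.stepIncr H (fun j => -gradient VS (QS j)) (fun k j => -gradient VF (QF k j))

/-- The positions after one macro-step. -/
def nextQ (S : PMGARK M sP sQ sPF sQF) {d : ℕ}
    (TS TF : EuclideanSpace ℝ (Fin d) → ℝ) (H : ℝ) (q₀ : EuclideanSpace ℝ (Fin d))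
    (PS : Fin sP → EuclideanSpace ℝ (Fin d)) (PF : ∀ k, Fin (sPF k) → EuclideanSpace ℝ (Fin d)) :
    EuclideanSpace ℝ (Fin d) :=
  q₀ + S.bar.stepIncr H (fun j => gradient TS (PS j)) (fun k j => gradient TF (PF k j))

/-- Order (at least) `r` for separable Hamiltonian systems with smooth Hamiltonians: the local
error of `p` and `q` is `O(H^(r+1))`, as for `MGARK.HasOrder`. -/
def HasOrder (S : PMGARK M sP sQ sPF sQF) (r : ℕ) : Prop :=
  ∀ (d : ℕ) (TS TF VS VF : EuclideanSpace ℝ (Fin d) → ℝ),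
    ContDiff ℝ ∞ TS → ContDiff ℝ ∞ TF → ContDiff ℝ ∞ VS → ContDiff ℝ ∞ VF →
    ∀ p q : ℝ → EuclideanSpace ℝ (Fin d),
    (∀ᶠ t in 𝓝 0, HasDerivAt p (-gradient VS (q t) - gradient VF (q t)) t) →
    (∀ᶠ t in 𝓝 0, HasDerivAt q (gradient TS (p t) + gradient TF (p t)) t) →
    ∀ (PS : ℝ → Fin sP → EuclideanSpace ℝ (Fin d))
      (PF : ℝ → ∀ k, Fin (sPF k) → EuclideanSpace ℝ (Fin d))
      (QS : ℝ → Fin sQ → EuclideanSpace ℝ (Fin d))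
      (QF : ℝ → ∀ k, Fin (sQF k) → EuclideanSpace ℝ (Fin d)),
    (∀ᶠ H in 𝓝[>] 0,
      S.IsStages TS TF VS VF H (p 0) (q 0) (PS H) (PF H) (QS H) (QF H)) →
    (∀ i, Tendsto (fun H => PS H i) (𝓝[>] 0) (𝓝 (p 0))) →
    (∀ k i, Tendsto (fun H => PF H k i) (𝓝[>] 0) (𝓝 (p 0))) →
    (∀ i, Tendsto (fun H => QS H i) (𝓝[>] 0) (𝓝 (q 0))) →
    (∀ k i, Tendsto (fun H => QF H k i) (𝓝[>] 0) (𝓝 (q 0))) →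
    (fun H => S.nextP VS VF H (p 0) (QS H) (QF H) - p H) =O[𝓝[>] 0] (fun H => H ^ (r + 1)) ∧
    (fun H => S.nextQ TS TF H (q 0) (PS H) (PF H) - q H) =O[𝓝[>] 0] (fun H => H ^ (r + 1))

/-- Order-one conditions. -/
def OrderOne (S : PMGARK M sP sQ sPF sQF) : Prop := S.bar.OrderOne ∧ S.til.OrderOne

/-- Order-two conditions. -/
def OrderTwo (S : PMGARK M sP sQ sPF sQF) : Prop :=
  (S.bar.SlowTwo S.til ∧ S.bar.FastTwo S.til) ∧ (S.til.SlowTwo S.bar ∧ S.til.FastTwo S.bar)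

/-- Order-two conditions, in the form for equal weight sums in all micro-steps. -/
def OrderTwoUniform (S : PMGARK M sP sQ sPF sQF) : Prop :=
  (S.bar.SlowTwo S.til ∧ S.bar.FastTwoUniform S.til) ∧
  (S.til.SlowTwo S.bar ∧ S.til.FastTwoUniform S.bar)

/-- Order-three conditions. -/
def OrderThree (S : PMGARK M sP sQ sPF sQF) : Prop :=
  (S.bar.SlowThree S.til ∧ S.bar.FastThree S.til) ∧
  (S.til.SlowThree S.bar ∧ S.til.FastThree S.bar)

/-- Order-three conditions, in the form for uniform micro-steps. -/
def OrderThreeUniform (S : PMGARK M sP sQ sPF sQF) : Prop :=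
  (S.bar.SlowThreeUniform S.til ∧ S.bar.FastThreeUniform S.til) ∧
  (S.til.SlowThreeUniform S.bar ∧ S.til.FastThreeUniform S.bar)

/-- A partitioned scheme is symmetric if both of its tableaux are. -/
def IsSymmetric (S : PMGARK M sP sQ sPF sQF) : Prop := S.bar.IsSymmetric ∧ S.til.IsSymmetric

/-- The weight sums of either tableau are the same in all micro-steps. -/
def UniformWt (S : PMGARK M sP sQ sPF sQF) : Prop := S.bar.UniformWt ∧ S.til.UniformWt

/-- The second-order sums of the fast base schemes are the same in all micro-steps. -/
def UniformTwo (S : PMGARK M sP sQ sPF sQF) : Prop :=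
  S.bar.UniformTwo S.til ∧ S.til.UniformTwo S.bar

end

end PMGARK

namespace MGARK

variable {M s : ℕ} {sF : Fin M → ℕ}

/-- Order-two conditions. -/
def OrderTwo (S : MGARK M s sF) : Prop := MRTableau.SlowTwo S S ∧ MRTableau.FastTwo S S

/-- Order-two conditions, in the form for equal weight sums in all micro-steps. -/
def OrderTwoUniform (S : MGARK M s sF) : Prop :=
  MRTableau.SlowTwo S S ∧ MRTableau.FastTwoUniform S S

/-- Order-three conditions. -/
def OrderThree (S : MGARK M s sF) : Prop := MRTableau.SlowThree S S ∧ MRTableau.FastThree S S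

/-- Order-three conditions, in the form for uniform micro-steps. -/
def OrderThreeUniform (S : MGARK M s sF) : Prop :=
  MRTableau.SlowThreeUniform S S ∧ MRTableau.FastThreeUniform S S

end MGARK

/-! A multirate scheme is one large Runge-Kutta method with step `H` whose stages carry a colour,
slow or fast; the micro-step `H / M` is absorbed by a factor `1 / M` in every fast column. Both
kinds of scheme are instances of a partitioned method for `p' = ∑ c, f c q`, `q' = ∑ c, g c p`; an
ordinary scheme is the case `p = q = y` with equal tableaux. The order conditions are those of
rooted trees with at most three vertices whose vertices are coloured in all possible ways.

Sufficiency: the stages and the exact solution are expanded up to `t ^ 3`. Each coefficient of the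
numerical solution is a sum of elementary differentials over all colourings of a tree
(`sum_smul_color`). If the weight of a tree is the same number for all colourings, the sum collapses
to that number times the elementary differential of the whole vector field, as in the exact solution
(`IsColoredStep.exists_expansion`). The block structure of `flat` turns the coloured conditions into
the stated ones (`colorOne_iff`, `colorTwo_iff`, `colorThree_iff`).

Necessity: for any choice of three colours there is a polynomial separable Hamiltonian system on
which exact solution and stages are explicit, and four components of the error of `q` are a power of
`t` times the defect of one tree condition (`HasOrder.isBigO_test`). Exchanging `p` and `q` gives
the conditions for the other tableau. An ordinary scheme of order `r`, applied to Hamiltonian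
systems, is a partitioned one of order `r` with two equal tableaux (`HasOrder.toPartitioned`), so
its conditions are necessary too.

For uniform micro-steps, order one forces every weight sum to be `1`, so the sums over earlier
micro-steps are `λ - 1` and the conditions differ by explicit sums of powers. For symmetric
tableaux, the arguments of the second-order sums add up to a constant on each pair of mirrored
stages, so each sum is half of its trivial value. -/

/-! ### Taylor expansion of a smooth map along a curve -/

section Expansion

variable {E F : Type*} [NormedAddCommGroup E] [NormedSpace ℝ E]
  [NormedAddCommGroup F] [NormedSpace ℝ F]

/-- Mean value inequality: a function that vanishes at `0` and whose derivative is `O(‖z‖ ^ n)` is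
`O(‖z‖ ^ (n + 1))`. -/
theorem isBigO_pow_succ_of_hasFDerivAt {r : E → F} {r' : E → E →L[ℝ] F} {n : ℕ}
    (hr : ∀ᶠ z in 𝓝 0, HasFDerivAt r (r' z) z) (h0 : r 0 = 0)
    (hO : r' =O[𝓝 0] fun z => ‖z‖ ^ n) : r =O[𝓝 0] fun z => ‖z‖ ^ (n + 1) := by
  obtain ⟨c, hc, hb⟩ := hO.exists_nonneg
  obtain ⟨ε, hε, hball⟩ := Metric.eventually_nhds_iff_ball.1 (hr.and hb.bound)
  refine IsBigO.of_bound c ?_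
  filter_upwards [Metric.ball_mem_nhds (0 : E) hε] with z hz
  have hsub : ∀ x ∈ Metric.closedBall (0 : E) ‖z‖, x ∈ Metric.ball (0 : E) ε := by
    intro x hx
    rw [mem_closedBall_zero_iff] at hx
    rw [mem_ball_zero_iff] at hz ⊢
    exact hx.trans_lt hz
  have key := (convex_closedBall (0 : E) ‖z‖).norm_image_sub_le_of_norm_hasFDerivWithin_le
    (f := r) (f' := r') (C := c * ‖z‖ ^ n) (x := 0) (y := z)
    (fun x hx => (hball x (hsub x hx)).1.hasFDerivWithinAt)
    (fun x hx => by
      refine (hball x (hsub x hx)).2.trans ?_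
      rw [norm_pow, norm_norm]
      rw [mem_closedBall_zero_iff] at hx
      gcongr)
    (by simp) (by simp)
  rw [h0, sub_zero, sub_zero] at key
  rw [norm_pow, norm_norm, pow_succ, ← mul_assoc]
  exact key

theorem isBigO_pow_succ_of_hasDerivAt {r r' : ℝ → F} {n : ℕ}
    (hr : ∀ᶠ t in 𝓝 0, HasDerivAt r (r' t) t) (h0 : r 0 = 0)
    (hO : r' =O[𝓝 0] fun t : ℝ => t ^ n) : r =O[𝓝 0] fun t : ℝ => t ^ (n + 1) := by
  have hO' : (fun t => ContinuousLinearMap.toSpanSingleton ℝ (r' t))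
      =O[𝓝 0] fun t : ℝ => ‖t‖ ^ n := by
    refine IsBigO.trans (IsBigO.of_bound 1 (Eventually.of_forall fun t => ?_))
      (hO.trans (IsBigO.of_bound 1 (Eventually.of_forall fun t => ?_)))
    · simp
    · simp
  refine (isBigO_pow_succ_of_hasFDerivAt (hr.mono fun t ht => ht.hasFDerivAt) h0 hO').trans
    (IsBigO.of_bound 1 (Eventually.of_forall fun t => ?_))
  simp

theorem hasFDerivAt_add_left {g : E → F} (hg : ContDiff ℝ ∞ g) (x z : E) :
    HasFDerivAt (fun z => g (x + z)) (fderiv ℝ g (x + z)) z :=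
  (((hg.differentiable (by simp)) (x + z)).hasFDerivAt.comp z
    ((hasFDerivAt_id z).const_add x)).congr_fderiv (by ext; simp)

theorem taylor_isBigO_zero {g : E → F} (hg : ContDiff ℝ ∞ g) (x : E) :
    (fun z => g (x + z) - g x) =O[𝓝 0] fun z => ‖z‖ ^ 1 := by
  refine isBigO_pow_succ_of_hasFDerivAt (r' := fun z => fderiv ℝ g (x + z)) (n := 0)
    (Eventually.of_forall fun z => ?_) (by simp) ?_
  · exact (hasFDerivAt_add_left hg x z).sub_const _
  · have hc : Continuous fun z => fderiv ℝ g (x + z) :=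
      (hg.continuous_fderiv (by simp)).comp (continuous_const.add continuous_id)
    simpa using (hc.tendsto 0).isBigO_one ℝ

theorem taylor_isBigO_one {g : E → F} (hg : ContDiff ℝ ∞ g) (x : E) :
    (fun z => g (x + z) - g x - fderiv ℝ g x z) =O[𝓝 0] fun z => ‖z‖ ^ 2 := by
  refine isBigO_pow_succ_of_hasFDerivAt (r' := fun z => fderiv ℝ g (x + z) - fderiv ℝ g x) (n := 1)
    (Eventually.of_forall fun z => ?_) (by simp) ?_
  · exact ((hasFDerivAt_add_left hg x z).sub_const _).sub
      (fderiv ℝ g x).hasFDerivAt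
  · exact taylor_isBigO_zero (hg.fderiv_right (by simp)) x

theorem taylor_isBigO_two {g : E → F} (hg : ContDiff ℝ ∞ g) (x : E) :
    (fun z => g (x + z) - g x - fderiv ℝ g x z - (1 / 2 : ℝ) • fderiv ℝ (fderiv ℝ g) x z z)
      =O[𝓝 0] fun z => ‖z‖ ^ 3 := by
  -- By symmetry the quadratic form `1/2 D²g(x)(z, z)` has derivative `D²g(x) z`, so the derivative
  -- of the remainder is the first-order remainder of `fderiv ℝ g`.
  have hsymm : IsSymmSndFDerivAt ℝ g x :=
    (hg.contDiffAt).isSymmSndFDerivAt (by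
      rw [minSmoothness_of_isRCLikeNormedField]; exact WithTop.coe_le_coe.2 le_top)
  refine isBigO_pow_succ_of_hasFDerivAt
    (r' := fun z => fderiv ℝ g (x + z) - fderiv ℝ g x - fderiv ℝ (fderiv ℝ g) x z) (n := 2)
    (Eventually.of_forall fun z => ?_) (by simp) ?_
  · have h1 := ((hasFDerivAt_add_left hg x z).sub_const
      (g x)).sub (fderiv ℝ g x).hasFDerivAt
    have h2 := (((fderiv ℝ (fderiv ℝ g) x).hasFDerivAt (x := z)).clm_apply
      (hasFDerivAt_id z)).const_smul (1 / 2 : ℝ)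
    refine (h1.sub h2).congr_fderiv ?_
    ext w
    simp only [sub_apply, smul_apply,
      add_apply, ContinuousLinearMap.comp_apply, ContinuousLinearMap.flip_apply,
      ContinuousLinearMap.id_apply, id]
    rw [hsymm w z, ← two_smul ℝ, smul_smul]
    norm_num
  · exact taylor_isBigO_one (hg.fderiv_right (by simp)) x

variable {l : Filter ℝ}

theorem isBigO_pow_of_le (hl : l ≤ 𝓝 0) {m n : ℕ} (h : m ≤ n) :
    (fun t : ℝ => t ^ n) =O[l] fun t => t ^ m := by
  refine IsBigO.mono ?_ hl
  obtain ⟨k, rfl⟩ := Nat.exists_eq_add_of_le h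
  have : (fun t : ℝ => t ^ k) =O[𝓝 0] fun _ => (1 : ℝ) :=
    ((continuous_pow k).tendsto (0 : ℝ)).isBigO_one ℝ
  simpa [pow_add] using (isBigO_refl (fun t : ℝ => t ^ m) (𝓝 0)).mul this

theorem isBigO_pow_smul_const (n : ℕ) (x : E) :
    (fun t : ℝ => t ^ n • x) =O[l] fun t => t ^ n := by
  simpa using (isBigO_refl (fun t : ℝ => t ^ n) l).smul (isBigO_refl (fun _ : ℝ => x) l |>.trans
    (isBigO_const_const x (one_ne_zero : (1 : ℝ) ≠ 0) l))

theorem tendsto_of_isBigO_pow_one (hl : l ≤ 𝓝 0) {z : ℝ → E}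
    (hz : z =O[l] fun t : ℝ => t ^ 1) : Tendsto z l (𝓝 0) :=
  hz.trans_tendsto (by simpa [Tendsto] using hl)

theorem isBigO_comp_of_taylor (hl : l ≤ 𝓝 0) {z : ℝ → E}
    (hz : z =O[l] fun t : ℝ => t ^ 1) {r : E → F} {n : ℕ} (hr : r =O[𝓝 0] fun z => ‖z‖ ^ n) :
    (fun t => r (z t)) =O[l] fun t => t ^ n := by
  refine (hr.comp_tendsto (tendsto_of_isBigO_pow_one hl hz)).trans ?_
  exact (hz.norm_left.pow n).congr_right fun t => by rw [pow_one]

theorem expansion_zero (hl : l ≤ 𝓝 0) {g : E → F} (hg : ContDiff ℝ ∞ g) {P : ℝ → E} {p₀ : E}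
    (hP : (fun t => P t - p₀) =O[l] fun t : ℝ => t ^ 1) :
    (fun t => g (P t) - g p₀) =O[l] fun t : ℝ => t ^ 1 := by
  simpa using isBigO_comp_of_taylor hl hP (taylor_isBigO_zero hg p₀)

theorem expansion_one (hl : l ≤ 𝓝 0) {g : E → F} (hg : ContDiff ℝ ∞ g) {P : ℝ → E} {p₀ x : E}
    (hP : (fun t => P t - p₀ - t • x) =O[l] fun t : ℝ => t ^ 2) :
    (fun t => g (P t) - g p₀ - t • fderiv ℝ g p₀ x) =O[l] fun t : ℝ => t ^ 2 := by
  have h1 : (fun t => P t - p₀) =O[l] fun t : ℝ => t ^ 1 := by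
    have := (hP.trans (isBigO_pow_of_le hl one_le_two)).add (isBigO_pow_smul_const 1 x)
    simpa using this
  have h2 := isBigO_comp_of_taylor hl h1 (taylor_isBigO_one hg p₀)
  refine (h2.add (((fderiv ℝ g p₀).isBigO_comp _ l).trans hP)).congr_left fun t => ?_
  simp only [add_sub_cancel, map_sub, map_smul]
  abel

theorem expansion_two (hl : l ≤ 𝓝 0) {g : E → F} (hg : ContDiff ℝ ∞ g) {P : ℝ → E} {p₀ x x₂ : E}
    (hP : (fun t => P t - p₀ - t • x - t ^ 2 • x₂) =O[l] fun t : ℝ => t ^ 3) :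
    (fun t => g (P t) - g p₀ - t • fderiv ℝ g p₀ x
      - t ^ 2 • (fderiv ℝ g p₀ x₂ + (1 / 2 : ℝ) • fderiv ℝ (fderiv ℝ g) p₀ x x))
      =O[l] fun t : ℝ => t ^ 3 := by
  have h1' : (fun t => P t - p₀ - t • x) =O[l] fun t : ℝ => t ^ 2 := by
    have := (hP.trans (isBigO_pow_of_le hl (by norm_num : 2 ≤ 3))).add (isBigO_pow_smul_const 2 x₂)
    simpa using this
  have h1 : (fun t => P t - p₀) =O[l] fun t : ℝ => t ^ 1 := by
    have := (h1'.trans (isBigO_pow_of_le hl one_le_two)).add (isBigO_pow_smul_const 1 x)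
    simpa using this
  have hx : (fun t : ℝ => t • x) =O[l] fun t : ℝ => t ^ 1 := by
    simpa using isBigO_pow_smul_const (l := l) 1 x
  have h2 := isBigO_comp_of_taylor hl h1 (taylor_isBigO_two hg p₀)
  set D := fderiv ℝ (fderiv ℝ g) p₀
  -- With `z = P t - p₀`, the quadratic term is corrected by `D z z - D (t x) (t x) = D (z - t x) z
  -- + D (t x) (z - t x)`; both summands are `O(t ^ 3)`.
  have bil : ∀ {u v : ℝ → E} {m n : ℕ}, u =O[l] (fun t : ℝ => t ^ m) →
      v =O[l] (fun t : ℝ => t ^ n) → (fun t => D (u t) (v t)) =O[l] fun t : ℝ => t ^ (m + n) := by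
    intro u v m n hu hv
    refine IsBigO.trans (IsBigO.of_bound ‖D‖ (Eventually.of_forall fun t => ?_))
      ((hu.norm_left.mul hv.norm_left).congr_right fun t => (pow_add t m n).symm)
    have := D.le_opNorm₂ (u t) (v t)
    simpa [mul_assoc] using this
  have h3 := ((bil h1' h1).add (bil (m := 1) hx h1')).const_smul_left (1 / 2 : ℝ)
  refine ((h2.add (((fderiv ℝ g p₀).isBigO_comp _ l).trans hP)).add h3).congr_left fun t => ?_
  simp only [Pi.smul_apply, add_sub_cancel, map_sub, map_smul, sub_apply,
    smul_apply, smul_add, smul_sub, smul_smul]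
  module

end Expansion

/-! ### Expansions of the exact solution and of the stages of a partitioned method -/

section BipartiteSystem

variable {E F : Type*} [NormedAddCommGroup E] [NormedSpace ℝ E]
  [NormedAddCommGroup F] [NormedSpace ℝ F]

section Exact

variable {f : F → E} {g : E → F} {p : ℝ → E} {q : ℝ → F}

theorem exact_isBigO_one (hg : ContDiff ℝ ∞ g)
    (hp : ∀ᶠ t in 𝓝 0, HasDerivAt p (f (q t)) t) (hq : ∀ᶠ t in 𝓝 0, HasDerivAt q (g (p t)) t) :
    (fun t => q t - q 0) =O[𝓝 0] fun t : ℝ => t ^ 1 := by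
  refine isBigO_pow_succ_of_hasDerivAt (r' := fun t => g (p t)) (n := 0)
    (hq.mono fun t ht => ht.sub_const _) (by simp) ?_
  have hc : Tendsto (fun t => g (p t)) (𝓝 0) (𝓝 (g (p 0))) :=
    (hg.continuous.tendsto (p 0)).comp hp.self_of_nhds.continuousAt.tendsto
  simpa using hc.isBigO_one ℝ

/-- Picard iteration: an expansion of `p` is inserted into `q' = g p` and integrated, which gains
one power of `t`. The system is symmetric in `(f, p)` and `(g, q)`, so the expansion needed for `p`
is the preceding lemma with the roles exchanged; the same holds for the next two orders. -/
theorem exact_isBigO_two (hf : ContDiff ℝ ∞ f) (hg : ContDiff ℝ ∞ g)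
    (hp : ∀ᶠ t in 𝓝 0, HasDerivAt p (f (q t)) t) (hq : ∀ᶠ t in 𝓝 0, HasDerivAt q (g (p t)) t) :
    (fun t => q t - q 0 - t • g (p 0)) =O[𝓝 0] fun t : ℝ => t ^ 2 := by
  refine isBigO_pow_succ_of_hasDerivAt (r' := fun t => g (p t) - g (p 0)) (n := 1)
    (hq.mono fun t ht => ?_) (by simp) (expansion_zero le_rfl hg (exact_isBigO_one hf hq hp))
  exact ((ht.sub_const (q 0)).sub ((hasDerivAt_id t).smul_const (g (p 0)))).congr_deriv (by simp)

theorem exact_isBigO_three (hf : ContDiff ℝ ∞ f) (hg : ContDiff ℝ ∞ g)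
    (hp : ∀ᶠ t in 𝓝 0, HasDerivAt p (f (q t)) t) (hq : ∀ᶠ t in 𝓝 0, HasDerivAt q (g (p t)) t) :
    (fun t => q t - q 0 - t • g (p 0) - t ^ 2 • (1 / 2 : ℝ) • fderiv ℝ g (p 0) (f (q 0)))
      =O[𝓝 0] fun t : ℝ => t ^ 3 := by
  refine isBigO_pow_succ_of_hasDerivAt
    (r' := fun t => g (p t) - g (p 0) - t • fderiv ℝ g (p 0) (f (q 0))) (n := 2)
    (hq.mono fun t ht => ?_) (by simp) (expansion_one le_rfl hg (exact_isBigO_two hg hf hq hp))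
  refine (((ht.sub_const (q 0)).sub ((hasDerivAt_id t).smul_const (g (p 0)))).sub
    ((hasDerivAt_pow 2 t).smul_const _)).congr_deriv ?_
  norm_num
  module

theorem exact_isBigO_four (hf : ContDiff ℝ ∞ f) (hg : ContDiff ℝ ∞ g)
    (hp : ∀ᶠ t in 𝓝 0, HasDerivAt p (f (q t)) t) (hq : ∀ᶠ t in 𝓝 0, HasDerivAt q (g (p t)) t) :
    (fun t => q t - q 0 - t • g (p 0) - t ^ 2 • (1 / 2 : ℝ) • fderiv ℝ g (p 0) (f (q 0))
      - t ^ 3 • ((1 / 6 : ℝ) • fderiv ℝ g (p 0) (fderiv ℝ f (q 0) (g (p 0)))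
        + (1 / 6 : ℝ) • fderiv ℝ (fderiv ℝ g) (p 0) (f (q 0)) (f (q 0))))
      =O[𝓝 0] fun t : ℝ => t ^ 4 := by
  refine isBigO_pow_succ_of_hasDerivAt (n := 3)
    (hq.mono fun t ht => ?_) (by simp) (expansion_two le_rfl hg (exact_isBigO_three hg hf hq hp))
  refine ((((ht.sub_const (q 0)).sub ((hasDerivAt_id t).smul_const (g (p 0)))).sub
    ((hasDerivAt_pow 2 t).smul_const _)).sub ((hasDerivAt_pow 3 t).smul_const _)).congr_deriv ?_
  norm_num
  module

end Exact

section Stages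

variable {ι κ : Type*} [Fintype ι] [Fintype κ] {l : Filter ℝ}

/-- The factor `t` in the stage equations gains one order. Alternating this with the Taylor
expansion of the slopes raises the accuracy of the stages one order at a time, also for implicit
tableaux. -/
theorem isBigO_smul_sum_sub {s σ : ι → ℝ → E} {n : ℕ} (c : ι → ℝ)
    (h : ∀ i, (fun t => s i t - σ i t) =O[l] fun t : ℝ => t ^ n) :
    (fun t => t • ∑ i, c i • s i t - t • ∑ i, c i • σ i t) =O[l] fun t : ℝ => t ^ (n + 1) := by
  have h1 : (fun t => ∑ i, c i • (s i t - σ i t)) =O[l] fun t : ℝ => t ^ n :=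
    (IsBigO.sum (s := Finset.univ) fun i _ => (h i).const_smul_left (c i)).congr_left
      fun t => by simp
  refine (((isBigO_refl (fun t : ℝ => t) l).smul h1).congr_left fun t => ?_).congr_right
    fun t => ?_
  · simp only [smul_sub, Finset.sum_sub_distrib]
  · rw [smul_eq_mul, pow_succ']

variable {f : ι → F → E} {g : κ → E → F} {P : ℝ → κ → E} {Q : ℝ → ι → F} {p₀ : E} {q₀ : F}
  {B : Matrix ι κ ℝ} {C : Matrix κ ι ℝ}

theorem stage_isBigO_one (hf : ∀ i, ContDiff ℝ ∞ (f i))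
    (hP : ∀ᶠ t in l, ∀ j, P t j = p₀ + t • ∑ i, C j i • f i (Q t i))
    (hQ0 : ∀ i, Tendsto (fun t => Q t i) l (𝓝 q₀)) (j : κ) :
    (fun t => P t j - p₀) =O[l] fun t : ℝ => t ^ 1 := by
  -- The only use made of the convergence of the stages: the slopes stay bounded.
  have h : ∀ i, (fun t => f i (Q t i) - 0) =O[l] fun t : ℝ => t ^ 0 := fun i => by
    simpa using (((hf i).continuous.tendsto q₀).comp (hQ0 i)).isBigO_one ℝ
  refine (isBigO_smul_sum_sub (C j) h).congr' ?_ EventuallyEq.rfl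
  filter_upwards [hP] with t ht
  simp [ht j]

theorem stage_isBigO_two (hl : l ≤ 𝓝 0)
    (hf : ∀ i, ContDiff ℝ ∞ (f i)) (hg : ∀ j, ContDiff ℝ ∞ (g j))
    (hP : ∀ᶠ t in l, ∀ j, P t j = p₀ + t • ∑ i, C j i • f i (Q t i))
    (hQ : ∀ᶠ t in l, ∀ i, Q t i = q₀ + t • ∑ j, B i j • g j (P t j))
    (hP0 : ∀ j, Tendsto (fun t => P t j) l (𝓝 p₀)) (j : κ) :
    (fun t => P t j - p₀ - t • ∑ i, C j i • f i q₀) =O[l] fun t : ℝ => t ^ 2 := by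
  refine (isBigO_smul_sum_sub (C j) fun i => expansion_zero hl (hf i)
    (stage_isBigO_one hg hQ hP0 i)).congr' ?_ EventuallyEq.rfl
  filter_upwards [hP] with t ht
  simp [ht j]

theorem stage_isBigO_three (hl : l ≤ 𝓝 0)
    (hf : ∀ i, ContDiff ℝ ∞ (f i)) (hg : ∀ j, ContDiff ℝ ∞ (g j))
    (hP : ∀ᶠ t in l, ∀ j, P t j = p₀ + t • ∑ i, C j i • f i (Q t i))
    (hQ : ∀ᶠ t in l, ∀ i, Q t i = q₀ + t • ∑ j, B i j • g j (P t j))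
    (hQ0 : ∀ i, Tendsto (fun t => Q t i) l (𝓝 q₀)) (j : κ) :
    (fun t => P t j - p₀ - t • ∑ i, C j i • f i q₀
      - t ^ 2 • ∑ i, C j i • fderiv ℝ (f i) q₀ (∑ m, B i m • g m p₀)) =O[l] fun t : ℝ => t ^ 3 := by
  have h := isBigO_smul_sum_sub (C j) (n := 2)
    (s := fun i t => f i (Q t i))
    (σ := fun i t => f i q₀ + t • fderiv ℝ (f i) q₀ (∑ m, B i m • g m p₀)) fun i => by
      simpa only [sub_sub] using
        expansion_one hl (hf i) (stage_isBigO_two hl hg hf hQ hP hQ0 i)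
  refine h.congr' ?_ EventuallyEq.rfl
  filter_upwards [hP] with t ht
  rw [ht j]
  simp only [smul_add, Finset.sum_add_distrib, Finset.smul_sum, smul_smul, pow_two]
  simp only [mul_comm, mul_left_comm]
  abel

theorem step_isBigO_four (hl : l ≤ 𝓝 0) (b : κ → ℝ)
    (hf : ∀ i, ContDiff ℝ ∞ (f i)) (hg : ∀ j, ContDiff ℝ ∞ (g j))
    (hP : ∀ᶠ t in l, ∀ j, P t j = p₀ + t • ∑ i, C j i • f i (Q t i))
    (hQ : ∀ᶠ t in l, ∀ i, Q t i = q₀ + t • ∑ j, B i j • g j (P t j))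
    (hQ0 : ∀ i, Tendsto (fun t => Q t i) l (𝓝 q₀)) :
    (fun t => t • ∑ j, b j • g j (P t j) - t • ∑ j, b j • g j p₀
      - t ^ 2 • ∑ j, b j • fderiv ℝ (g j) p₀ (∑ i, C j i • f i q₀)
      - t ^ 3 • (∑ j, b j • fderiv ℝ (g j) p₀
          (∑ i, C j i • fderiv ℝ (f i) q₀ (∑ m, B i m • g m p₀))
        + (1 / 2 : ℝ) • ∑ j, b j • fderiv ℝ (fderiv ℝ (g j)) p₀
          (∑ i, C j i • f i q₀) (∑ i, C j i • f i q₀))) =O[l] fun t : ℝ => t ^ 4 := by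
  have h := isBigO_smul_sum_sub b (n := 3)
    (s := fun j t => g j (P t j))
    (σ := fun j t => g j p₀ + t • fderiv ℝ (g j) p₀ (∑ i, C j i • f i q₀)
      + t ^ 2 • (fderiv ℝ (g j) p₀ (∑ i, C j i • fderiv ℝ (f i) q₀ (∑ m, B i m • g m p₀))
        + (1 / 2 : ℝ) • fderiv ℝ (fderiv ℝ (g j)) p₀
          (∑ i, C j i • f i q₀) (∑ i, C j i • f i q₀))) fun j => by
      simpa only [sub_sub] using
        expansion_two hl (hg j) (stage_isBigO_three hl hf hg hP hQ hQ0 j)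
  refine h.congr_left fun t => ?_
  simp only [smul_add, Finset.sum_add_distrib, Finset.smul_sum (N := F), smul_smul]
  have e2 : ∀ j, t * (b j * t) = t ^ 2 * b j := fun j => by ring
  have e3 : ∀ j, t * (b j * t ^ 2) = t ^ 3 * b j := fun j => by ring
  have e4 : ∀ j, t * (b j * (t ^ 2 * (1 / 2))) = t ^ 3 * (1 / 2 * b j) := fun j => by ring
  simp only [e2, e3, e4]
  abel

end Stages

end BipartiteSystem

/-! ### Order conditions for coloured trees and the local error -/

section ColoredConditions

/-- The indicator of the colour `c`. -/
def colorInd (c k : Bool) : ℝ := if k = c then 1 else 0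

theorem sum_smul_color {κ V : Type*} [Fintype κ] [AddCommGroup V] [Module ℝ V] (w : κ → ℝ)
    (col : κ → Bool) (T : Bool → V) :
    ∑ j, w j • T (col j) = ∑ c, (∑ j, w j * colorInd c (col j)) • T c := by
  simp only [Finset.sum_smul]
  rw [Finset.sum_comm]
  refine Finset.sum_congr rfl fun j _ => ?_
  simp [colorInd]

variable {ι κ : Type*} [Fintype ι] [Fintype κ]

/-- Order-one conditions for a Runge-Kutta method whose stages carry colours. -/
def ColorOne (b : κ → ℝ) (ck : κ → Bool) : Prop :=
  ∀ c, ∑ j, b j * colorInd c (ck j) = 1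

/-- Order-two conditions for a partitioned Runge-Kutta method whose stages carry colours. -/
def ColorTwo (b : κ → ℝ) (C : Matrix κ ι ℝ) (ck : κ → Bool) (ci : ι → Bool) : Prop :=
  ∀ c a, ∑ j, b j * colorInd c (ck j) * ∑ i, C j i * colorInd a (ci i) = 1 / 2

/-- Order-three conditions for the bushy trees. -/
def ColorBushy (b : κ → ℝ) (C : Matrix κ ι ℝ) (ck : κ → Bool) (ci : ι → Bool) : Prop :=
  ∀ c a a', ∑ j, b j * colorInd c (ck j) * ((∑ i, C j i * colorInd a (ci i)) *
    ∑ i, C j i * colorInd a' (ci i)) = 1 / 3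

/-- Order-three conditions for the tall trees. -/
def ColorTall (b : κ → ℝ) (B : Matrix ι κ ℝ) (C : Matrix κ ι ℝ) (ck : κ → Bool)
    (ci : ι → Bool) : Prop :=
  ∀ c a c', ∑ j, b j * colorInd c (ck j) * ∑ i, C j i * colorInd a (ci i) *
    ∑ m, B i m * colorInd c' (ck m) = 1 / 6

variable {b : κ → ℝ} {B : Matrix ι κ ℝ} {C : Matrix κ ι ℝ} {ck : κ → Bool} {ci : ι → Bool}
  {E F : Type*} [NormedAddCommGroup E] [NormedSpace ℝ E]
  [NormedAddCommGroup F] [NormedSpace ℝ F]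

theorem ColorOne.sum_eq (h : ColorOne b ck) (T : Bool → F) : ∑ j, b j • T (ck j) = ∑ c, T c := by
  simp only [sum_smul_color, h _, one_smul]

/-- By multilinearity the left side is a sum over all colourings of the tree, each elementary
differential multiplied by the weight of its colouring. As all these weights are equal, the constant
factors out and the colour sums recombine to the whole vector fields. The two lemmas that follow do
the same for the trees with three vertices. -/
theorem ColorTwo.sum_eq (h : ColorTwo b C ck ci) (T : Bool → E →L[ℝ] F) (x : Bool → E) :
    ∑ j, b j • T (ck j) (∑ i, C j i • x (ci i)) = (1 / 2 : ℝ) • (∑ c, T c) (∑ a, x a) := by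
  have e : ∀ j, b j • T (ck j) (∑ i, C j i • x (ci i))
      = ∑ a, (b j * ∑ i, C j i * colorInd a (ci i)) • T (ck j) (x a) := fun j => by
    rw [sum_smul_color (C j) ci x]
    simp only [map_sum, map_smul, Finset.smul_sum (N := F), smul_smul]
  have key : ∀ a, ∑ j, (b j * ∑ i, C j i * colorInd a (ci i)) • T (ck j) (x a)
      = ∑ c, (1 / 2 : ℝ) • T c (x a) := fun a => by
    rw [sum_smul_color (fun j => b j * ∑ i, C j i * colorInd a (ci i)) ck fun c => T c (x a)]
    refine Finset.sum_congr rfl fun c _ => ?_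
    rw [← h c a]
    simp only [mul_right_comm]
  simp only [e]
  rw [Finset.sum_comm]
  simp only [key, map_sum, sum_apply, Finset.smul_sum]

theorem ColorBushy.sum_eq (h : ColorBushy b C ck ci) (D : Bool → E →L[ℝ] E →L[ℝ] F)
    (x : Bool → E) :
    ∑ j, b j • D (ck j) (∑ i, C j i • x (ci i)) (∑ i, C j i • x (ci i))
      = (1 / 3 : ℝ) • (∑ c, D c) (∑ a, x a) (∑ a, x a) := by
  have e : ∀ j, b j • D (ck j) (∑ i, C j i • x (ci i)) (∑ i, C j i • x (ci i))
      = ∑ a, ∑ a', (b j * ((∑ i, C j i * colorInd a (ci i)) *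
        ∑ i, C j i * colorInd a' (ci i))) • D (ck j) (x a) (x a') := fun j => by
    rw [sum_smul_color (C j) ci x]
    simp only [map_sum, map_smul, Finset.smul_sum (N := F), smul_smul, sum_apply,
      smul_apply]
    rw [Finset.sum_comm]
    exact Finset.sum_congr rfl fun a _ => Finset.sum_congr rfl fun a' _ => by
      rw [mul_comm (∑ i, C j i * colorInd a' (ci i))]
  have key : ∀ a a', ∑ j, (b j * ((∑ i, C j i * colorInd a (ci i)) *
        ∑ i, C j i * colorInd a' (ci i))) • D (ck j) (x a) (x a')
      = ∑ c, (1 / 3 : ℝ) • D c (x a) (x a') := fun a a' => by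
    rw [sum_smul_color (fun j => b j * ((∑ i, C j i * colorInd a (ci i)) *
      ∑ i, C j i * colorInd a' (ci i))) ck fun c => D c (x a) (x a')]
    refine Finset.sum_congr rfl fun c _ => ?_
    rw [← h c a a']
    simp only [mul_right_comm]
  calc _ = ∑ a, ∑ a', ∑ j, (b j * ((∑ i, C j i * colorInd a (ci i)) *
        ∑ i, C j i * colorInd a' (ci i))) • D (ck j) (x a) (x a') := by
        simp only [e]
        rw [Finset.sum_comm]
        exact Finset.sum_congr rfl fun a _ => Finset.sum_comm
    _ = _ := by
        simp only [key, Fintype.sum_bool, map_add, add_apply, smul_add]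
        abel

theorem ColorTall.sum_eq (h : ColorTall b B C ck ci) (T : Bool → E →L[ℝ] F)
    (R : Bool → F →L[ℝ] E) (x : Bool → F) :
    ∑ j, b j • T (ck j) (∑ i, C j i • R (ci i) (∑ m, B i m • x (ck m)))
      = (1 / 6 : ℝ) • (∑ c, T c) ((∑ a, R a) (∑ c, x c)) := by
  have e1 : ∀ j, ∑ i, C j i • R (ci i) (∑ m, B i m • x (ck m))
      = ∑ c', ∑ a, (∑ i, C j i * colorInd a (ci i) * ∑ m, B i m * colorInd c' (ck m)) •
        R a (x c') := fun j => by
    simp only [sum_smul_color _ ck x, map_sum, map_smul, Finset.smul_sum (N := E), smul_smul]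
    rw [Finset.sum_comm]
    refine Finset.sum_congr rfl fun c' _ => ?_
    rw [sum_smul_color (fun i => C j i * ∑ m, B i m * colorInd c' (ck m)) ci fun a => R a (x c')]
    simp only [mul_right_comm]
  have e : ∀ j, b j • T (ck j) (∑ i, C j i • R (ci i) (∑ m, B i m • x (ck m)))
      = ∑ c', ∑ a, (b j * ∑ i, C j i * colorInd a (ci i) * ∑ m, B i m * colorInd c' (ck m)) •
        T (ck j) (R a (x c')) := fun j => by
    rw [e1 j]
    simp only [map_sum, map_smul, Finset.smul_sum (N := F), smul_smul]
  have key : ∀ c' a, ∑ j, (b j * ∑ i, C j i * colorInd a (ci i) *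
        ∑ m, B i m * colorInd c' (ck m)) • T (ck j) (R a (x c'))
      = ∑ c, (1 / 6 : ℝ) • T c (R a (x c')) := fun c' a => by
    rw [sum_smul_color (fun j => b j * ∑ i, C j i * colorInd a (ci i) *
        ∑ m, B i m * colorInd c' (ck m)) ck fun c => T c (R a (x c'))]
    refine Finset.sum_congr rfl fun c _ => ?_
    rw [← h c a c']
    simp only [mul_right_comm (b _)]
  calc _ = ∑ c', ∑ a, ∑ j, (b j * ∑ i, C j i * colorInd a (ci i) *
        ∑ m, B i m * colorInd c' (ck m)) • T (ck j) (R a (x c')) := by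
        simp only [e]
        rw [Finset.sum_comm]
        exact Finset.sum_congr rfl fun a _ => Finset.sum_comm
    _ = _ := by
        simp only [key, Fintype.sum_bool, map_add, add_apply, smul_add]

section LocalError

variable {f : Bool → F → E} {g : Bool → E → F} {p : ℝ → E} {q : ℝ → F}
  {P : ℝ → κ → E} {Q : ℝ → ι → F} {l : Filter ℝ}

/-- The data of a step of a partitioned Runge-Kutta method for the system
`p' = ∑ c, f c q`, `q' = ∑ c, g c p`: the exact solution `p`, `q` and stages `P`, `Q` that solve
the stage equations with step size `t → 0`. -/
structure IsColoredStep (B : Matrix ι κ ℝ) (C : Matrix κ ι ℝ) (ck : κ → Bool) (ci : ι → Bool)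
    (f : Bool → F → E) (g : Bool → E → F) (p : ℝ → E) (q : ℝ → F)
    (P : ℝ → κ → E) (Q : ℝ → ι → F) (l : Filter ℝ) : Prop where
  le_nhds : l ≤ 𝓝 0
  smooth_f : ∀ c, ContDiff ℝ ∞ (f c)
  smooth_g : ∀ c, ContDiff ℝ ∞ (g c)
  deriv_p : ∀ᶠ t in 𝓝 0, HasDerivAt p (∑ c, f c (q t)) t
  deriv_q : ∀ᶠ t in 𝓝 0, HasDerivAt q (∑ c, g c (p t)) t
  stage_P : ∀ᶠ t in l, ∀ j, P t j = p 0 + t • ∑ i, C j i • f (ci i) (Q t i)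
  stage_Q : ∀ᶠ t in l, ∀ i, Q t i = q 0 + t • ∑ j, B i j • g (ck j) (P t j)
  tendsto_P : ∀ j, Tendsto (fun t => P t j) l (𝓝 (p 0))
  tendsto_Q : ∀ i, Tendsto (fun t => Q t i) l (𝓝 (q 0))

theorem fderiv_sum_color (hg : ∀ c, ContDiff ℝ ∞ (g c)) :
    fderiv ℝ (fun x => ∑ c, g c x) = fun x => ∑ c, fderiv ℝ (g c) x := by
  ext1 x
  exact fderiv_fun_sum fun c _ => (hg c).differentiable (by simp) x

/-- The vectors `x₁`, `x₂`, `x₃` are the differences of the Taylor coefficients of the numerical and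
the exact solution. All three orders share this one expansion; each further set of conditions
removes one more term. -/
theorem IsColoredStep.exists_expansion (h : IsColoredStep B C ck ci f g p q P Q l)
    (b : κ → ℝ) : ∃ x₁ x₂ x₃ : F,
    (fun t => (q 0 + t • ∑ j, b j • g (ck j) (P t j)) - q t - t • x₁ - t ^ 2 • x₂ - t ^ 3 • x₃)
      =O[l] (fun t : ℝ => t ^ 4) ∧
    (ColorOne b ck → x₁ = 0) ∧ (ColorTwo b C ck ci → x₂ = 0) ∧
    (ColorBushy b C ck ci → ColorTall b B C ck ci → x₃ = 0) := by
  have hstep := step_isBigO_four h.le_nhds b (fun i => h.smooth_f (ci i))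
    (fun j => h.smooth_g (ck j)) h.stage_P h.stage_Q h.tendsto_Q
  have hexact := exact_isBigO_four (f := fun x => ∑ c, f c x) (g := fun x => ∑ c, g c x)
    (ContDiff.sum fun c _ => h.smooth_f c) (ContDiff.sum fun c _ => h.smooth_g c)
    h.deriv_p h.deriv_q
  have hsub := hstep.sub (hexact.mono h.le_nhds)
  refine ⟨∑ j, b j • g (ck j) (p 0) - ∑ c, g c (p 0),
    ∑ j, b j • fderiv ℝ (g (ck j)) (p 0) (∑ i, C j i • f (ci i) (q 0)) -
      (1 / 2 : ℝ) • fderiv ℝ (fun x => ∑ c, g c x) (p 0) (∑ c, f c (q 0)),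
    (∑ j, b j • fderiv ℝ (g (ck j)) (p 0)
          (∑ i, C j i • fderiv ℝ (f (ci i)) (q 0) (∑ m, B i m • g (ck m) (p 0)))
        + (1 / 2 : ℝ) • ∑ j, b j • fderiv ℝ (fderiv ℝ (g (ck j))) (p 0)
          (∑ i, C j i • f (ci i) (q 0)) (∑ i, C j i • f (ci i) (q 0))) -
      ((1 / 6 : ℝ) • fderiv ℝ (fun x => ∑ c, g c x) (p 0) (fderiv ℝ (fun x => ∑ c, f c x) (q 0)
          (∑ c, g c (p 0)))
        + (1 / 6 : ℝ) • fderiv ℝ (fderiv ℝ (fun x => ∑ c, g c x)) (p 0) (∑ c, f c (q 0))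
          (∑ c, f c (q 0))),
    hsub.congr_left fun t => ?_, fun h1 => ?_, fun h2 => ?_, fun h3 h4 => ?_⟩
  · simp only [smul_sub]
    abel
  · rw [h1.sum_eq fun c => g c (p 0), sub_self]
  · rw [h2.sum_eq (fun c => fderiv ℝ (g c) (p 0)) (fun a => f a (q 0)),
      fderiv_sum_color h.smooth_g, sub_self]
  -- The Taylor factor `1/2` times the bushy weight `1/3` gives the `1/6` of the exact solution; the
  -- tall weight is `1/6` already.
  · rw [h4.sum_eq (fun c => fderiv ℝ (g c) (p 0)) (fun a => fderiv ℝ (f a) (q 0))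
      (fun c => g c (p 0)),
      h3.sum_eq (fun c => fderiv ℝ (fderiv ℝ (g c)) (p 0)) (fun a => f a (q 0)),
      fderiv_sum_color h.smooth_g, fderiv_sum_color h.smooth_f,
      fderiv_sum_color (g := fun c => fderiv ℝ (g c)) fun c => (h.smooth_g c).fderiv_right (by simp),
      smul_smul]
    norm_num

theorem IsColoredStep.isBigO_two (h : IsColoredStep B C ck ci f g p q P Q l)
    (h1 : ColorOne b ck) :
    (fun t => (q 0 + t • ∑ j, b j • g (ck j) (P t j)) - q t) =O[l] fun t : ℝ => t ^ 2 := by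
  obtain ⟨x₁, x₂, x₃, hx, e1, -, -⟩ := h.exists_expansion b
  have := ((hx.trans (isBigO_pow_of_le h.le_nhds (by norm_num : 2 ≤ 4))).add
    (isBigO_pow_smul_const 2 x₂)).add ((isBigO_pow_smul_const 3 x₃).trans
      (isBigO_pow_of_le h.le_nhds (by norm_num : 2 ≤ 3)))
  refine this.congr_left fun t => ?_
  rw [e1 h1]
  module

theorem IsColoredStep.isBigO_three (h : IsColoredStep B C ck ci f g p q P Q l)
    (h1 : ColorOne b ck) (h2 : ColorTwo b C ck ci) :
    (fun t => (q 0 + t • ∑ j, b j • g (ck j) (P t j)) - q t) =O[l] fun t : ℝ => t ^ 3 := by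
  obtain ⟨x₁, x₂, x₃, hx, e1, e2, -⟩ := h.exists_expansion b
  have := (hx.trans (isBigO_pow_of_le h.le_nhds (by norm_num : 3 ≤ 4))).add
    (isBigO_pow_smul_const 3 x₃)
  refine this.congr_left fun t => ?_
  rw [e1 h1, e2 h2]
  module

theorem IsColoredStep.isBigO_four (h : IsColoredStep B C ck ci f g p q P Q l)
    (h1 : ColorOne b ck) (h2 : ColorTwo b C ck ci) (h3 : ColorBushy b C ck ci)
    (h4 : ColorTall b B C ck ci) :
    (fun t => (q 0 + t • ∑ j, b j • g (ck j) (P t j)) - q t) =O[l] fun t : ℝ => t ^ 4 := by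
  obtain ⟨x₁, x₂, x₃, hx, e1, e2, e3⟩ := h.exists_expansion b
  refine hx.congr_left fun t => ?_
  rw [e1 h1, e2 h2, e3 h3 h4]
  module

end LocalError

end ColoredConditions

/-! ### The multirate tableau as a single coloured Runge-Kutta tableau -/

namespace MRTableau

noncomputable section

section Flatten

/-- The index type of all stages, with the slow ones on the left and the fast ones on the right. -/
abbrev Idx {M : ℕ} (n : ℕ) (nF : Fin M → ℕ) := Fin n ⊕ (Σ k, Fin (nF k))

/-- The colour of a stage: `false` for a slow and `true` for a fast one. -/
abbrev color {M n : ℕ} {nF : Fin M → ℕ} (x : Idx n nF) : Bool := x.isRight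

/-- A family of slow slopes and fast slopes as a family indexed by all stages. -/
abbrev join {M n : ℕ} {nF : Fin M → ℕ} {E : Type*} (XS : Fin n → E) (XF : ∀ k, Fin (nF k) → E) :
    Idx n nF → E :=
  Sum.elim XS fun x => XF x.1 x.2

variable {M rS cS : ℕ} {rF cF : Fin M → ℕ} {E : Type*} [AddCommGroup E] [Module ℝ E]

/-- The whole tableau as one matrix. -/
def flat (B : MRTableau M rS cS rF cF) : Matrix (Idx rS rF) (Idx cS cF) ℝ
  | .inl i, .inl j => B.Ass i j
  | .inl i, .inr y => (M : ℝ)⁻¹ * B.Asf y.1 i y.2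
  | .inr x, .inl j => B.Afs x.1 x.2 j
  | .inr x, .inr y => (M : ℝ)⁻¹ * ((if y.1 < x.1 then B.bf y.1 y.2 else 0) +
      if h : y.1 = x.1 then B.Aff x.1 x.2 (h ▸ y.2) else 0)

/-- All weights as one vector. -/
def flatWt (B : MRTableau M rS cS rF cF) : Idx cS cF → ℝ
  | .inl j => B.bs j
  | .inr y => (M : ℝ)⁻¹ * B.bf y.1 y.2

variable (B : MRTableau M rS cS rF cF)

theorem sum_flatWt_smul (v : Idx cS cF → E) :
    ∑ y, B.flatWt y • v y = ∑ j, B.bs j • v (.inl j)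
      + (M : ℝ)⁻¹ • ∑ k, ∑ j, B.bf k j • v (.inr ⟨k, j⟩) := by
  simp only [Fintype.sum_sum_type, Fintype.sum_sigma, flatWt, Finset.smul_sum, smul_smul]

theorem sum_flat_inl_smul (i : Fin rS) (v : Idx cS cF → E) :
    ∑ y, B.flat (.inl i) y • v y = ∑ j, B.Ass i j • v (.inl j)
      + (M : ℝ)⁻¹ • ∑ k, ∑ j, B.Asf k i j • v (.inr ⟨k, j⟩) := by
  simp only [Fintype.sum_sum_type, Fintype.sum_sigma, flat, Finset.smul_sum, smul_smul]

/-- A fast row of micro-step `k` has three kinds of fast blocks: the full weights of the earlier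
micro-steps, its own block `Aff k`, and zero for the later ones. -/
theorem sum_flat_inr_smul (k : Fin M) (i : Fin (rF k)) (v : Idx cS cF → E) :
    ∑ y, B.flat (.inr ⟨k, i⟩) y • v y = ∑ j, B.Afs k i j • v (.inl j)
      + (M : ℝ)⁻¹ • (∑ l ∈ Finset.Iio k, ∑ j, B.bf l j • v (.inr ⟨l, j⟩)
        + ∑ j, B.Aff k i j • v (.inr ⟨k, j⟩)) := by
  have h1 : ∑ l, ∑ j, (if l < k then B.bf l j else 0) • v (.inr ⟨l, j⟩)
      = ∑ l ∈ Finset.Iio k, ∑ j, B.bf l j • v (.inr ⟨l, j⟩) := by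
    rw [← Finset.filter_gt_eq_Iio, Finset.sum_filter]
    refine Finset.sum_congr rfl fun l _ => ?_
    split_ifs <;> simp
  have h2 : ∑ l, ∑ j, (if h : l = k then B.Aff k i (h ▸ j) else 0) • v (.inr ⟨l, j⟩)
      = ∑ j, B.Aff k i j • v (.inr ⟨k, j⟩) := by
    rw [Finset.sum_eq_single k]
    · simp
    · intro l _ hl
      simp [hl]
    · simp
  rw [← h1, ← h2]
  simp only [Fintype.sum_sum_type, Fintype.sum_sigma, flat, Finset.smul_sum, smul_smul,
    ← Finset.sum_add_distrib, smul_add, add_smul, mul_add]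

variable (H : ℝ) (FS : Fin cS → E) (FF : ∀ k, Fin (cF k) → E)

theorem slowIncr_eq (i : Fin rS) :
    B.slowIncr H FS FF i = H • ∑ y, B.flat (.inl i) y • join FS FF y := by
  rw [sum_flat_inl_smul, smul_add, smul_smul, ← div_eq_mul_inv]
  rfl

theorem fastIncr_eq (k : Fin M) (i : Fin (rF k)) :
    B.fastIncr H FS FF k i = H • ∑ y, B.flat (.inr ⟨k, i⟩) y • join FS FF y := by
  rw [sum_flat_inr_smul, smul_add, smul_smul, ← div_eq_mul_inv, smul_add, ← add_assoc,
    add_comm (H • _)]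
  rfl

theorem stepIncr_eq : B.stepIncr H FS FF = H • ∑ y, B.flatWt y • join FS FF y := by
  rw [sum_flatWt_smul, smul_add, smul_smul, ← div_eq_mul_inv, add_comm]
  rfl

theorem sum_flatWt_slow (v : Idx cS cF → ℝ) :
    ∑ y, B.flatWt y * colorInd false (color y) * v y = B.bs ⬝ᵥ fun j => v (.inl j) := by
  have := B.sum_flatWt_smul fun y => colorInd false (color y) * v y
  simpa [colorInd, ← mul_assoc, dotProduct] using this

theorem sum_flatWt_fast (v : Idx cS cF → ℝ) :
    ∑ y, B.flatWt y * colorInd true (color y) * v y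
      = (M : ℝ)⁻¹ * ∑ k, B.bf k ⬝ᵥ fun j => v (.inr ⟨k, j⟩) := by
  have := B.sum_flatWt_smul fun y => colorInd true (color y) * v y
  simpa [colorInd, ← mul_assoc, dotProduct] using this

theorem flat_slow_slow (w : Idx cS cF → ℝ) :
    (fun i => ∑ y, B.flat (.inl i) y * colorInd false (color y) * w y)
      = B.Ass *ᵥ fun j => w (.inl j) := by
  ext i
  have := B.sum_flat_inl_smul i fun y => colorInd false (color y) * w y
  simpa [colorInd, ← mul_assoc, Matrix.mulVec, dotProduct] using this

theorem flat_slow_fast (w : Idx cS cF → ℝ) :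
    (fun i => ∑ y, B.flat (.inl i) y * colorInd true (color y) * w y)
      = (M : ℝ)⁻¹ • ∑ k, B.Asf k *ᵥ fun j => w (.inr ⟨k, j⟩) := by
  ext i
  have := B.sum_flat_inl_smul i fun y => colorInd true (color y) * w y
  simpa [colorInd, ← mul_assoc, Matrix.mulVec, dotProduct] using this

theorem flat_fast_slow (k : Fin M) (w : Idx cS cF → ℝ) :
    (fun i => ∑ y, B.flat (.inr ⟨k, i⟩) y * colorInd false (color y) * w y)
      = B.Afs k *ᵥ fun j => w (.inl j) := by
  ext i
  have := B.sum_flat_inr_smul k i fun y => colorInd false (color y) * w y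
  simpa [colorInd, ← mul_assoc, Matrix.mulVec, dotProduct] using this

theorem flat_fast_fast (k : Fin M) (w : Idx cS cF → ℝ) :
    (fun i => ∑ y, B.flat (.inr ⟨k, i⟩) y * colorInd true (color y) * w y)
      = (M : ℝ)⁻¹ • ((B.Aff k *ᵥ fun j => w (.inr ⟨k, j⟩))
        + (∑ l ∈ Finset.Iio k, B.bf l ⬝ᵥ fun j => w (.inr ⟨l, j⟩)) • 1) := by
  ext i
  have := B.sum_flat_inr_smul k i fun y => colorInd true (color y) * w y
  rw [add_comm (B.Aff k *ᵥ _)]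
  simpa [colorInd, ← mul_assoc, Matrix.mulVec, dotProduct] using this

end Flatten

/-! ### Translation of the coloured conditions into the block conditions -/

section Conditions

variable {M rS cS : ℕ} {rF cF : Fin M → ℕ} (B : MRTableau M rS cS rF cF)
  (C : MRTableau M cS rS cF rF)

/-- Source of `wtAfter` in the third-order fast conditions: a stage of micro-step `l` is felt,
through the completed micro-step, in all micro-steps `k > l`, and exchanging the two sums collects
their weights. -/
theorem sum_mul_sum_Iio_eq (x : Fin M → ℝ) :
    ∑ k, B.wt k * ∑ l ∈ Finset.Iio k, x l = ∑ k, B.wtAfter k * x k := by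
  simp only [wtAfter, Finset.mul_sum, Finset.sum_mul]
  exact Finset.sum_comm' (by simp)

theorem colorOne_iff (hM : (M : ℝ) ≠ 0) : ColorOne B.flatWt color ↔ B.OrderOne := by
  have hs := B.sum_flatWt_slow 1
  have hf := B.sum_flatWt_fast 1
  simp only [Pi.one_apply, mul_one] at hs hf
  simp only [ColorOne, Bool.forall_bool, hs, hf, inv_mul_eq_one₀ hM]
  exact ⟨fun h => ⟨h.1, h.2.symm⟩, fun h => ⟨h.1, h.2.symm⟩⟩

theorem flat_slow_slow_one : (fun i => ∑ y, B.flat (.inl i) y * colorInd false (color y))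
    = B.Ass *ᵥ 1 := by
  have h := B.flat_slow_slow 1
  simp only [Pi.one_apply, mul_one] at h
  exact h

theorem flat_slow_fast_one : (fun i => ∑ y, B.flat (.inl i) y * colorInd true (color y))
    = (M : ℝ)⁻¹ • ∑ k, B.Asf k *ᵥ 1 := by
  have h := B.flat_slow_fast 1
  simp only [Pi.one_apply, mul_one] at h
  exact h

theorem flat_fast_slow_one (k : Fin M) :
    (fun i => ∑ y, B.flat (.inr ⟨k, i⟩) y * colorInd false (color y)) = B.Afs k *ᵥ 1 := by
  have h := B.flat_fast_slow k 1
  simp only [Pi.one_apply, mul_one] at h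
  exact h

theorem flat_fast_fast_one (k : Fin M) :
    (fun i => ∑ y, B.flat (.inr ⟨k, i⟩) y * colorInd true (color y))
      = (M : ℝ)⁻¹ • (B.Aff k *ᵥ 1 + B.wtBefore k • 1) := by
  have h := B.flat_fast_fast k 1
  simp only [Pi.one_apply, mul_one] at h
  exact h

/-- Each fast vertex of the tree contributes a factor `1 / M`; this is the origin of the powers of
`M` on the right-hand sides, here and for the trees with three vertices. -/
theorem colorTwo_iff (hM : (M : ℝ) ≠ 0) :
    ColorTwo B.flatWt C.flat color color ↔ B.SlowTwo C ∧ B.FastTwo C := by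
  simp only [ColorTwo, Bool.forall_bool, sum_flatWt_slow, sum_flatWt_fast, flat_slow_slow_one,
    flat_slow_fast_one, flat_fast_slow_one, flat_fast_fast_one, dotProduct_smul, smul_eq_mul,
    ← Finset.mul_sum]
  have e1 : ∀ x : ℝ, (M : ℝ)⁻¹ * x = 1 / 2 ↔ x = M / 2 := fun x => by field_simp
  have e2 : ∀ x : ℝ, (M : ℝ)⁻¹ * ((M : ℝ)⁻¹ * x) = 1 / 2 ↔ x = (M : ℝ) ^ 2 / 2 := fun x => by
    field_simp
  rw [e2, e1, e1]
  exact ⟨fun h => ⟨⟨h.1.1, h.1.2⟩, ⟨h.2.2, h.2.1⟩⟩, fun h => ⟨⟨h.1.1, h.1.2⟩, ⟨h.2.2, h.2.1⟩⟩⟩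

theorem fun_mul_eq_diagonal_mulVec {n : ℕ} (x y : Fin n → ℝ) :
    (fun j => x j * y j) = Matrix.diagonal x *ᵥ y := by
  ext j
  rw [Matrix.mulVec_diagonal]

theorem colorBushy_iff (hM : (M : ℝ) ≠ 0) :
    ColorBushy B.flatWt C.flat color color ↔
      (B.bs ⬝ᵥ (Matrix.diagonal (C.Ass *ᵥ 1) *ᵥ (C.Ass *ᵥ 1)) = 1 / 3 ∧
      B.bs ⬝ᵥ (Matrix.diagonal (C.Ass *ᵥ 1) *ᵥ (∑ k, C.Asf k *ᵥ 1)) = M / 3 ∧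
      B.bs ⬝ᵥ (Matrix.diagonal (∑ k, C.Asf k *ᵥ 1) *ᵥ (∑ k, C.Asf k *ᵥ 1)) = (M : ℝ) ^ 2 / 3) ∧
      (∑ k, B.bf k ⬝ᵥ (Matrix.diagonal (C.Aff k *ᵥ 1 + C.wtBefore k • 1)
        *ᵥ (C.Aff k *ᵥ 1 + C.wtBefore k • 1)) = (M : ℝ) ^ 3 / 3 ∧
      ∑ k, B.bf k ⬝ᵥ (Matrix.diagonal (C.Aff k *ᵥ 1 + C.wtBefore k • 1)
        *ᵥ (C.Afs k *ᵥ 1)) = (M : ℝ) ^ 2 / 3 ∧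
      ∑ k, B.bf k ⬝ᵥ (Matrix.diagonal (C.Afs k *ᵥ 1) *ᵥ (C.Afs k *ᵥ 1)) = M / 3) := by
  -- The two leaves of the bushy tree may be interchanged, so the eight colourings give only six
  -- distinct conditions.
  have comm : ∀ {n : ℕ} (x y : Fin n → ℝ), Matrix.diagonal x *ᵥ y = Matrix.diagonal y *ᵥ x :=
    fun x y => by simp only [← fun_mul_eq_diagonal_mulVec, mul_comm]
  have smul : ∀ {n : ℕ} (c : ℝ) (x y : Fin n → ℝ),
      Matrix.diagonal (c • x) *ᵥ y = c • (Matrix.diagonal x *ᵥ y) := fun c x y => by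
    rw [comm, Matrix.mulVec_smul, comm]
  simp only [ColorBushy, Bool.forall_bool, sum_flatWt_slow, sum_flatWt_fast,
    fun_mul_eq_diagonal_mulVec, flat_slow_slow_one,
    flat_slow_fast_one, flat_fast_slow_one, flat_fast_fast_one]
  simp only [smul, Matrix.mulVec_smul, dotProduct_smul, smul_eq_mul, ← Finset.mul_sum]
  have e1 : ∀ x : ℝ, (M : ℝ)⁻¹ * x = 1 / 3 ↔ x = M / 3 := fun x => by field_simp
  have e2 : ∀ x : ℝ, (M : ℝ)⁻¹ * ((M : ℝ)⁻¹ * x) = 1 / 3 ↔ x = (M : ℝ) ^ 2 / 3 := fun x => by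
    field_simp
  have e3 : ∀ x : ℝ, (M : ℝ)⁻¹ * ((M : ℝ)⁻¹ * ((M : ℝ)⁻¹ * x)) = 1 / 3 ↔ x = (M : ℝ) ^ 3 / 3 :=
    fun x => by field_simp
  simp only [e3, e2, e1, comm (∑ k, C.Asf k *ᵥ 1) (C.Ass *ᵥ 1), comm (C.Afs _ *ᵥ 1) (_ + _)]
  tauto

theorem colorTall_iff (hM : (M : ℝ) ≠ 0) :
    ColorTall B.flatWt B.flat C.flat color color ↔
      (B.bs ⬝ᵥ (C.Ass *ᵥ (B.Ass *ᵥ 1)) = 1 / 6 ∧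
      B.bs ⬝ᵥ (C.Ass *ᵥ (∑ k, B.Asf k *ᵥ 1)) = M / 6 ∧
      B.bs ⬝ᵥ (∑ k, C.Asf k *ᵥ (B.Afs k *ᵥ 1)) = M / 6 ∧
      B.bs ⬝ᵥ (∑ k, C.Asf k *ᵥ (B.Aff k *ᵥ 1 + B.wtBefore k • 1)) = (M : ℝ) ^ 2 / 6) ∧
      (∑ k, (B.bf k ⬝ᵥ (C.Aff k *ᵥ (B.Aff k *ᵥ 1 + B.wtBefore k • 1))
        + B.wtAfter k * (C.bf k ⬝ᵥ (B.Aff k *ᵥ 1 + B.wtBefore k • 1))) = (M : ℝ) ^ 3 / 6 ∧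
      ∑ k, (B.bf k ⬝ᵥ (C.Aff k *ᵥ (B.Afs k *ᵥ 1))
        + B.wtAfter k * (C.bf k ⬝ᵥ (B.Afs k *ᵥ 1))) = (M : ℝ) ^ 2 / 6 ∧
      ∑ k, B.bf k ⬝ᵥ (C.Afs k *ᵥ (∑ l, B.Asf l *ᵥ 1)) = (M : ℝ) ^ 2 / 6 ∧
      ∑ k, B.bf k ⬝ᵥ (C.Afs k *ᵥ (B.Ass *ᵥ 1)) = M / 6) := by
  -- Fast root and fast middle vertex; `w` is the vector contributed by the last vertex.
  have ff : ∀ w : ∀ k, Fin (rF k) → ℝ,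
      ∑ k, B.bf k ⬝ᵥ ((M : ℝ)⁻¹ • (C.Aff k *ᵥ w k
        + (∑ l ∈ Finset.Iio k, C.bf l ⬝ᵥ w l) • 1))
      = (M : ℝ)⁻¹ * ∑ k, (B.bf k ⬝ᵥ (C.Aff k *ᵥ w k) + B.wtAfter k * (C.bf k ⬝ᵥ w k)) := fun w => by
    simp only [dotProduct_smul (M : ℝ)⁻¹, smul_eq_mul, ← Finset.mul_sum]
    congr 1
    simp only [dotProduct_add, dotProduct_smul, smul_eq_mul, Finset.sum_add_distrib]
    rw [← sum_mul_sum_Iio_eq]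
    simp only [wt, mul_comm]
  -- The variant for a last vertex that is fast as well, so that its vector carries a further `1 /
  -- M`.
  have ff' : ∀ w : ∀ k, Fin (rF k) → ℝ,
      ∑ k, B.bf k ⬝ᵥ ((M : ℝ)⁻¹ • (C.Aff k *ᵥ ((M : ℝ)⁻¹ • w k)
        + (∑ l ∈ Finset.Iio k, C.bf l ⬝ᵥ ((M : ℝ)⁻¹ • w l)) • 1))
      = (M : ℝ)⁻¹ * ((M : ℝ)⁻¹ * ∑ k, (B.bf k ⬝ᵥ (C.Aff k *ᵥ w k) + B.wtAfter k * (C.bf k ⬝ᵥ w k))) :=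
      fun w => by
    rw [ff fun k => (M : ℝ)⁻¹ • w k]
    congr 1
    rw [Finset.mul_sum]
    refine Finset.sum_congr rfl fun k _ => ?_
    simp only [Matrix.mulVec_smul, dotProduct_smul, smul_eq_mul]
    ring
  simp only [ColorTall, Bool.forall_bool, sum_flatWt_slow, sum_flatWt_fast,
    flat_slow_slow, flat_slow_fast, flat_fast_slow, flat_fast_fast, flat_slow_slow_one,
    flat_slow_fast_one, flat_fast_slow_one, flat_fast_fast_one]
  rw [ff', ff]
  simp only [Matrix.mulVec_smul, dotProduct_smul, smul_eq_mul, ← Finset.mul_sum,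
    ← Finset.smul_sum]
  have e1 : ∀ x : ℝ, (M : ℝ)⁻¹ * x = 1 / 6 ↔ x = M / 6 := fun x => by field_simp
  have e2 : ∀ x : ℝ, (M : ℝ)⁻¹ * ((M : ℝ)⁻¹ * x) = 1 / 6 ↔ x = (M : ℝ) ^ 2 / 6 := fun x => by
    field_simp
  have e3 : ∀ x : ℝ, (M : ℝ)⁻¹ * ((M : ℝ)⁻¹ * ((M : ℝ)⁻¹ * x)) = 1 / 6 ↔ x = (M : ℝ) ^ 3 / 6 :=
    fun x => by field_simp
  simp only [e3, e2, e1]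
  tauto

theorem colorThree_iff (hM : (M : ℝ) ≠ 0) :
    ColorBushy B.flatWt C.flat color color ∧ ColorTall B.flatWt B.flat C.flat color color ↔
      B.SlowThree C ∧ B.FastThree C := by
  rw [B.colorBushy_iff C hM, B.colorTall_iff C hM]
  constructor
  · rintro ⟨⟨⟨h1, h2, h3⟩, h4, h5, h6⟩, ⟨h7, h8, h9, h10⟩, h11, h12, h13, h14⟩
    exact ⟨⟨h1, h2, h3, h7, h8, h9, h10⟩, ⟨h4, h5, h6, h11, h12, h13, h14⟩⟩
  · rintro ⟨⟨h1, h2, h3, h7, h8, h9, h10⟩, ⟨h4, h5, h6, h11, h12, h13, h14⟩⟩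
    exact ⟨⟨⟨h1, h2, h3⟩, h4, h5, h6⟩, ⟨h7, h8, h9, h10⟩, h11, h12, h13, h14⟩

end Conditions

end

end MRTableau

/-! ### Both kinds of scheme as coloured steps -/

/-- Error estimates are proved for `q` only; this transfers them to `p`. -/
theorem IsColoredStep.symm {ι κ E F : Type*} [Fintype ι] [Fintype κ]
    [NormedAddCommGroup E] [NormedSpace ℝ E] [NormedAddCommGroup F] [NormedSpace ℝ F]
    {B : Matrix ι κ ℝ} {C : Matrix κ ι ℝ} {ck : κ → Bool} {ci : ι → Bool}
    {f : Bool → F → E} {g : Bool → E → F} {p : ℝ → E} {q : ℝ → F}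
    {P : ℝ → κ → E} {Q : ℝ → ι → F} {l : Filter ℝ}
    (h : IsColoredStep B C ck ci f g p q P Q l) : IsColoredStep C B ci ck g f q p Q P l :=
  ⟨h.le_nhds, h.smooth_g, h.smooth_f, h.deriv_q, h.deriv_p, h.stage_Q, h.stage_P, h.tendsto_Q,
    h.tendsto_P⟩

theorem ContDiff.gradient {F : Type*} [NormedAddCommGroup F] [InnerProductSpace ℝ F]
    [CompleteSpace F] {V : F → ℝ} (hV : ContDiff ℝ ∞ V) : ContDiff ℝ ∞ (gradient V) :=
  (InnerProductSpace.toDual ℝ F).symm.toContinuousLinearEquiv.contDiff.comp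
    (hV.fderiv_right (m := ∞) (by simp))

namespace MRTableau

variable {M rS cS : ℕ} {rF cF : Fin M → ℕ} {E : Type*} [AddCommGroup E] [Module ℝ E]

theorem stage_equations_iff (B : MRTableau M rS cS rF cF) (H : ℝ) (x₀ : E) (XS : Fin rS → E)
    (XF : ∀ k, Fin (rF k) → E) (FS : Fin cS → E) (FF : ∀ k, Fin (cF k) → E) :
    ((∀ i, XS i = x₀ + B.slowIncr H FS FF i) ∧ ∀ k i, XF k i = x₀ + B.fastIncr H FS FF k i) ↔
      ∀ x, join XS XF x = x₀ + H • ∑ y, B.flat x y • join FS FF y := by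
  simp only [slowIncr_eq, fastIncr_eq, Sum.forall, Sigma.forall]
  rfl

theorem join_comp {n : ℕ} {nF : Fin M → ℕ} {X Y : Type*} (f : Bool → X → Y) (XS : Fin n → X)
    (XF : ∀ k, Fin (nF k) → X) (y : Idx n nF) :
    join (fun j => f false (XS j)) (fun k j => f true (XF k j)) y
      = f (color y) (join XS XF y) := by
  cases y <;> rfl

end MRTableau

open MRTableau

namespace MGARK

variable {M s : ℕ} {sF : Fin M → ℕ}

/-- An ordinary scheme is a coloured step whose two halves coincide, so the estimates for
partitioned methods apply without change. The colour `true` selects the fast field. -/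
theorem hasOrder_of_isColoredStep (S : MGARK M s sF) (r : ℕ)
    (h : ∀ (d : ℕ) (f : Bool → EuclideanSpace ℝ (Fin d) → EuclideanSpace ℝ (Fin d))
      (y : ℝ → EuclideanSpace ℝ (Fin d)) (Y : ℝ → Idx s sF → EuclideanSpace ℝ (Fin d)),
      IsColoredStep (flat S) (flat S) color color f f y y Y Y (𝓝[>] 0) →
      (fun t => (y 0 + t • ∑ j, flatWt S j • f (color j) (Y t j)) - y t)
        =O[𝓝[>] 0] fun t : ℝ => t ^ (r + 1)) :
    S.HasOrder r := by
  intro d fS fF hfS hfF y hy YS YF hst hYS hYF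
  have hst' : ∀ᶠ H in 𝓝[>] (0 : ℝ), ∀ x, join (YS H) (YF H) x
      = y 0 + H • ∑ z, flat S x z • (fun c => cond c fF fS) (color z) (join (YS H) (YF H) z) := by
    filter_upwards [hst] with H hH
    have := (stage_equations_iff S H _ _ _ _ _).1 hH
    simp only [← join_comp (fun c => cond c fF fS)]
    exact this
  have hten : ∀ x, Tendsto (fun H => join (YS H) (YF H) x) (𝓝[>] 0) (𝓝 (y 0)) := by
    rintro (i | ⟨k, i⟩)
    exacts [hYS i, hYF k i]
  have hsm : ∀ c, ContDiff ℝ ∞ ((fun c => cond c fF fS) c) := by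
    rintro (_ | _)
    exacts [hfS, hfF]
  have hd : ∀ᶠ t in 𝓝 0, HasDerivAt y (∑ c, (fun c => cond c fF fS) c (y t)) t := by
    filter_upwards [hy] with t ht
    simpa [add_comm] using ht
  refine (h d _ y _ ⟨nhdsWithin_le_nhds, hsm, hsm, hd, hd, hst', hst', hten, hten⟩).congr_left
    fun t => ?_
  simp only [next, stepIncr_eq, ← join_comp (fun c => cond c fF fS)]
  rfl

end MGARK

namespace PMGARK

variable {M sP sQ : ℕ} {sPF sQF : Fin M → ℕ}

theorem isStages_iff (S : PMGARK M sP sQ sPF sQF) {d : ℕ}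
    (TS TF VS VF : EuclideanSpace ℝ (Fin d) → ℝ) (H : ℝ) (p₀ q₀ : EuclideanSpace ℝ (Fin d))
    (PS : Fin sP → EuclideanSpace ℝ (Fin d)) (PF : ∀ k, Fin (sPF k) → EuclideanSpace ℝ (Fin d))
    (QS : Fin sQ → EuclideanSpace ℝ (Fin d)) (QF : ∀ k, Fin (sQF k) → EuclideanSpace ℝ (Fin d)) :
    S.IsStages TS TF VS VF H p₀ q₀ PS PF QS QF ↔
      (∀ x, join PS PF x = p₀ + H • ∑ y, S.til.flat x y •
        -gradient (cond (color y) VF VS) (join QS QF y)) ∧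
      (∀ x, join QS QF x = q₀ + H • ∑ y, S.bar.flat x y •
        gradient (cond (color y) TF TS) (join PS PF y)) := by
  have e1 := join_comp (n := sQ) (nF := sQF) (fun c x => -gradient (cond c VF VS) x) QS QF
  have e2 := join_comp (n := sP) (nF := sPF) (fun c x => gradient (cond c TF TS) x) PS PF
  simp only [cond_true, cond_false] at e1 e2
  simp only [IsStages, ← e1, ← e2, ← stage_equations_iff, and_assoc]

theorem nextQ_eq (S : PMGARK M sP sQ sPF sQF) {d : ℕ}
    (TS TF : EuclideanSpace ℝ (Fin d) → ℝ) (H : ℝ) (q₀ : EuclideanSpace ℝ (Fin d))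
    (PS : Fin sP → EuclideanSpace ℝ (Fin d)) (PF : ∀ k, Fin (sPF k) → EuclideanSpace ℝ (Fin d)) :
    S.nextQ TS TF H q₀ PS PF = q₀ + H • ∑ y, S.bar.flatWt y •
        gradient (cond (color y) TF TS) (join PS PF y) := by
  have e2 := join_comp (n := sP) (nF := sPF) (fun c x => gradient (cond c TF TS) x) PS PF
  simp only [cond_true, cond_false] at e2
  simp only [nextQ, stepIncr_eq, ← e2]

theorem nextP_eq (S : PMGARK M sP sQ sPF sQF) {d : ℕ}
    (VS VF : EuclideanSpace ℝ (Fin d) → ℝ) (H : ℝ) (p₀ : EuclideanSpace ℝ (Fin d))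
    (QS : Fin sQ → EuclideanSpace ℝ (Fin d)) (QF : ∀ k, Fin (sQF k) → EuclideanSpace ℝ (Fin d)) :
    S.nextP VS VF H p₀ QS QF = p₀ + H • ∑ y, S.til.flatWt y •
        -gradient (cond (color y) VF VS) (join QS QF y) := by
  have e1 := join_comp (n := sQ) (nF := sQF) (fun c x => -gradient (cond c VF VS) x) QS QF
  simp only [cond_true, cond_false] at e1
  simp only [nextP, stepIncr_eq, ← e1]

/-- A statement on the error in the second component of a step with tableaux `B` and `C`. -/
def ErrorBound (B : MRTableau M sQ sP sQF sPF) (C : MRTableau M sP sQ sPF sQF) (r : ℕ) : Prop :=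
  ∀ (d : ℕ) (f g : Bool → EuclideanSpace ℝ (Fin d) → EuclideanSpace ℝ (Fin d))
    (p q : ℝ → EuclideanSpace ℝ (Fin d)) (P : ℝ → Idx sP sPF → EuclideanSpace ℝ (Fin d))
    (Q : ℝ → Idx sQ sQF → EuclideanSpace ℝ (Fin d)),
    IsColoredStep B.flat C.flat color color f g p q P Q (𝓝[>] 0) →
    (fun t => (q 0 + t • ∑ j, B.flatWt j • g (color j) (P t j)) - q t)
      =O[𝓝[>] 0] fun t : ℝ => t ^ (r + 1)

theorem hasOrder_of_errorBound (S : PMGARK M sP sQ sPF sQF) (r : ℕ)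
    (hq : ErrorBound S.bar S.til r) (hp : ErrorBound S.til S.bar r) : S.HasOrder r := by
  intro d TS TF VS VF hTS hTF hVS hVF p q hp' hq' PS PF QS QF hst hPS hPF hQS hQF
  have hT : ∀ c, ContDiff ℝ ∞ ((fun c => gradient (cond c TF TS)) c) := by
    rintro (_ | _)
    exacts [hTS.gradient, hTF.gradient]
  have hV : ∀ c, ContDiff ℝ ∞ ((fun c x => -gradient (cond c VF VS) x) c) := by
    rintro (_ | _)
    exacts [hVS.gradient.neg, hVF.gradient.neg]
  have hstep : IsColoredStep S.bar.flat S.til.flat color color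
      (fun c x => -gradient (cond c VF VS) x) (fun c => gradient (cond c TF TS)) p q
      (fun H => join (PS H) (PF H)) (fun H => join (QS H) (QF H)) (𝓝[>] 0) := by
    refine ⟨nhdsWithin_le_nhds, hV, hT, ?_, ?_, ?_, ?_, ?_, ?_⟩
    · filter_upwards [hp'] with t ht
      simpa [sub_eq_add_neg, add_comm] using ht
    · filter_upwards [hq'] with t ht
      simpa [add_comm] using ht
    · exact hst.mono fun H hH => ((isStages_iff ..).1 hH).1
    · exact hst.mono fun H hH => ((isStages_iff ..).1 hH).2
    · rintro (i | ⟨k, i⟩)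
      exacts [hPS i, hPF k i]
    · rintro (i | ⟨k, i⟩)
      exacts [hQS i, hQF k i]
  simp only [nextP_eq, nextQ_eq]
  have hp1 := hp d _ _ q p _ _ hstep.symm
  have hq1 := hq d _ _ p q _ _ hstep
  exact ⟨hp1, hq1⟩

/-- The scheme with the roles of `p` and `q` exchanged. -/
def swap (S : PMGARK M sP sQ sPF sQF) : PMGARK M sQ sP sQF sPF := ⟨S.til, S.bar⟩

theorem gradient_neg_apply {F : Type*} [NormedAddCommGroup F] [InnerProductSpace ℝ F]
    [CompleteSpace F] (V : F → ℝ) (x : F) : gradient (fun y => -V y) x = -gradient V x := by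
  simp [gradient, fderiv_fun_neg]

/-- Exchanging `p` and `q` turns `p' = -∇V q`, `q' = ∇T p` into a system of the same form with
kinetic part `-V` and potential part `-T`. Hence conditions derived from the error of `q` also hold
with the two tableaux interchanged. -/
theorem HasOrder.swap {S : PMGARK M sP sQ sPF sQF} {r : ℕ} (h : S.HasOrder r) :
    S.swap.HasOrder r := by
  intro d TS TF VS VF hTS hTF hVS hVF p q hp' hq' PS PF QS QF hst hPS hPF hQS hQF
  have := h d (fun x => -VS x) (fun x => -VF x) (fun x => -TS x) (fun x => -TF x)
    hVS.neg hVF.neg hTS.neg hTF.neg q p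
    (by simpa only [gradient_neg_apply, neg_neg, sub_neg_eq_add] using hq')
    (by simpa only [gradient_neg_apply, ← sub_eq_add_neg] using hp') QS QF PS PF
    (by
      refine hst.mono fun H hH => ?_
      simp only [IsStages, gradient_neg_apply, neg_neg]
      exact ⟨hH.2.2.1, hH.2.2.2, hH.1, hH.2.1⟩) hQS hQF hPS hPF
  simp only [nextP, nextQ, gradient_neg_apply, neg_neg] at this
  exact this.symm

end PMGARK

/-! ### Necessity: a polynomial Hamiltonian test system -/

theorem eq_zero_of_pow_mul_isBigO {n r : ℕ} (hnr : n ≤ r) {c : ℝ}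
    (h : (fun t : ℝ => t ^ n * c) =O[𝓝[>] 0] fun t => t ^ (r + 1)) : c = 0 := by
  have h1 : (fun t : ℝ => t ^ n * c) =O[𝓝[>] 0] fun t => t ^ (n + 1) :=
    h.trans (isBigO_pow_of_le nhdsWithin_le_nhds (by omega))
  have h2 := (isBigO_refl (fun t : ℝ => (t ^ n)⁻¹) (𝓝[>] 0)).mul h1
  have h3 : (fun _ : ℝ => c) =O[𝓝[>] 0] fun t : ℝ => t := by
    refine h2.congr' ?_ ?_ <;> filter_upwards [self_mem_nhdsWithin] with t ht
    · exact inv_mul_cancel_left₀ (pow_ne_zero n (ne_of_gt ht)) c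
    · rw [pow_succ, inv_mul_cancel_left₀ (pow_ne_zero n (ne_of_gt ht))]
  have h4 : Tendsto (fun _ : ℝ => c) (𝓝[>] 0) (𝓝 0) :=
    h3.trans_tendsto (tendsto_id.mono_left nhdsWithin_le_nhds)
  exact tendsto_nhds_unique tendsto_const_nhds h4

namespace PMGARK

section TestSystem

/-- A potential whose Hamiltonian vector field, in a separable system, has coupled polynomial
solutions that realize all trees with three vertices. -/
def testT (β γ : ℝ) (p : EuclideanSpace ℝ (Fin 7)) : ℝ :=
  β * p 0 + γ * (p 1 * p 4 + p 1 * p 2 * p 5 + p 3 * p 6)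

/-- The counterpart of `testT` for the other half of the variables. -/
def testV (α β : ℝ) (q : EuclideanSpace ℝ (Fin 7)) : ℝ :=
  -(α * (q 1 + q 0 * q 3) + β * q 2)

theorem contDiff_testT (β γ : ℝ) : ContDiff ℝ ∞ (testT β γ) := by
  unfold testT
  fun_prop

theorem contDiff_testV (α β : ℝ) : ContDiff ℝ ∞ (testV α β) := by
  unfold testV
  fun_prop

theorem gradient_testT (β γ : ℝ) (p : EuclideanSpace ℝ (Fin 7)) :
    gradient (testT β γ) p = !₂[β, γ * (p 4 + p 2 * p 5), γ * (p 1 * p 5), γ * p 6, γ * p 1,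
      γ * (p 1 * p 2), γ * p 3] := by
  refine HasGradientAt.gradient (hasGradientAt_iff_hasFDerivAt.2 ?_)
  have hc : ∀ i : Fin 7, HasFDerivAt (fun p : EuclideanSpace ℝ (Fin 7) => p i)
    (EuclideanSpace.proj i : EuclideanSpace ℝ (Fin 7) →L[ℝ] ℝ) p := fun i =>
    (EuclideanSpace.proj i : EuclideanSpace ℝ (Fin 7) →L[ℝ] ℝ).hasFDerivAt
  refine (((hc 0).const_mul β).add (((((hc 1).mul (hc 4)).add
    (((hc 1).mul (hc 2)).mul (hc 5))).add ((hc 3).mul (hc 6))).const_mul γ)).congr_fderiv ?_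
  ext w
  simp [PiLp.inner_apply, Fin.sum_univ_succ]
  ring

theorem neg_gradient_testV (α β : ℝ) (q : EuclideanSpace ℝ (Fin 7)) :
    -gradient (testV α β) q = !₂[α * q 3, α, β, α * q 0, 0, 0, 0] := by
  unfold testV
  rw [gradient_neg_apply, neg_neg]
  refine HasGradientAt.gradient (hasGradientAt_iff_hasFDerivAt.2 ?_)
  have hc : ∀ i : Fin 7, HasFDerivAt (fun p : EuclideanSpace ℝ (Fin 7) => p i)
    (EuclideanSpace.proj i : EuclideanSpace ℝ (Fin 7) →L[ℝ] ℝ) q := fun i =>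
    (EuclideanSpace.proj i : EuclideanSpace ℝ (Fin 7) →L[ℝ] ℝ).hasFDerivAt
  refine ((((hc 1).add ((hc 0).mul (hc 3))).const_mul α).add
    ((hc 2).const_mul β)).congr_fderiv ?_
  ext w
  simp [PiLp.inner_apply, Fin.sum_univ_succ]
  ring

theorem hasDerivAt_euclidean {n : ℕ} {y : ℝ → EuclideanSpace ℝ (Fin n)}
    {y' : EuclideanSpace ℝ (Fin n)} {t : ℝ} (h : ∀ i, HasDerivAt (fun t => y t i) (y' i) t) :
    HasDerivAt y y' t := by
  rw [hasDerivAt_iff_hasFDerivAt, ← hasFDerivWithinAt_univ, hasFDerivWithinAt_euclidean]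
  intro i
  refine (h i).hasFDerivAt.hasFDerivWithinAt.congr_fderiv ?_
  ext
  simp

/-- The values of the momenta in the test system, with weights `A`, `A'`, `D` of the trees. -/
def testP (t A A' D : ℝ) : EuclideanSpace ℝ (Fin 7) := !₂[0, t * A, t * A', t ^ 2 * D, 0, 0, 0]

/-- The values of the positions in the test system, with weights `U`, `X`, `Y`, `Z` of the trees. -/
def testQ (t U X Y Z : ℝ) : EuclideanSpace ℝ (Fin 7) :=
  !₂[t * U, 0, 0, 0, t ^ 2 * X, t ^ 3 * Y, t ^ 3 * Z]

/-- Coordinates that are zero in `testP` and `testQ` stay zero, and the others grow one tree each: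
`p 1`, `p 2` and `q 0` a single vertex, `p 3` (over `q 0`) and `q 4` (over `p 1`) two vertices, `q
5` the bushy tree over `p 1`, `p 2`, and `q 6` the tall tree over `p 3`. -/
theorem gradient_testT_testP (β γ t A A' D : ℝ) :
    gradient (testT β γ) (testP t A A' D)
      = !₂[β, 0, 0, 0, γ * (t * A), γ * (t ^ 2 * (A * A')), γ * (t ^ 2 * D)] := by
  rw [gradient_testT]
  ext i
  fin_cases i <;> simp [testP]
  ring_nf
  simp

theorem neg_gradient_testV_testQ (α β t U X Y Z : ℝ) :
    -gradient (testV α β) (testQ t U X Y Z) = !₂[0, α, β, α * (t * U), 0, 0, 0] := by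
  rw [neg_gradient_testV]
  ext i
  fin_cases i <;> simp [testQ]

/-- The form of `testP` and `testQ` is reproduced by the stage equations. The dependence is
triangular: the slopes of `p` use only `U`, never `X`, `Y`, `Z`. The stages are therefore explicit
even for an implicit tableau. -/
theorem testP_eq_sum {ι : Type*} [Fintype ι] (t : ℝ) (w α β U X Y Z : ι → ℝ) :
    testP t (∑ i, w i * α i) (∑ i, w i * β i) (∑ i, w i * α i * U i) = 0 +
      t • ∑ i, w i • -gradient (testV (α i) (β i)) (testQ t (U i) (X i) (Y i) (Z i)) := by
  simp only [neg_gradient_testV_testQ]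
  ext i
  fin_cases i <;> simp [testP, Finset.mul_sum]
  exact Finset.sum_congr rfl fun j _ => by ring

theorem testQ_eq_sum {κ : Type*} [Fintype κ] (t : ℝ) (w β γ A A' D : κ → ℝ) :
    testQ t (∑ j, w j * β j) (∑ j, w j * γ j * A j) (∑ j, w j * γ j * (A j * A' j))
      (∑ j, w j * γ j * D j) = 0 +
      t • ∑ j, w j • gradient (testT (β j) (γ j)) (testP t (A j) (A' j) (D j)) := by
  simp only [gradient_testT_testP]
  ext i
  fin_cases i <;> simp [testQ, Finset.mul_sum] <;>
  exact Finset.sum_congr rfl fun j _ => by ring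

theorem continuous_testP (A A' D : ℝ) : Continuous fun t => testP t A A' D := by
  refine (PiLp.continuous_toLp 2 _).comp (continuous_pi fun i => ?_)
  fin_cases i <;> simp <;> fun_prop

theorem continuous_testQ (U X Y Z : ℝ) : Continuous fun t => testQ t U X Y Z := by
  refine (PiLp.continuous_toLp 2 _).comp (continuous_pi fun i => ?_)
  fin_cases i <;> simp <;> fun_prop

theorem hasDerivAt_testP (t : ℝ) : HasDerivAt (fun t => testP t 1 1 (1 / 2))
    !₂[0, 1, 1, t, 0, 0, 0] t := by
  refine hasDerivAt_euclidean fun i => ?_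
  fin_cases i <;> simp [testP]
  · exact hasDerivAt_const _ _
  · exact hasDerivAt_id _
  · exact hasDerivAt_id _
  · exact ((hasDerivAt_pow 2 t).mul_const _).congr_deriv (by norm_num; ring)
  all_goals exact hasDerivAt_const _ _

theorem hasDerivAt_testQ (t : ℝ) : HasDerivAt (fun t => testQ t 1 (1 / 2) (1 / 3) (1 / 6))
    !₂[1, 0, 0, 0, t, t ^ 2, t ^ 2 / 2] t := by
  refine hasDerivAt_euclidean fun i => ?_
  fin_cases i <;> simp [testQ]
  · exact hasDerivAt_id _
  · exact hasDerivAt_const _ _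
  · exact hasDerivAt_const _ _
  · exact hasDerivAt_const _ _
  · exact ((hasDerivAt_pow 2 t).mul_const _).congr_deriv (by norm_num; ring)
  · exact ((hasDerivAt_pow 3 t).mul_const _).congr_deriv (by norm_num; ring)
  · exact ((hasDerivAt_pow 3 t).mul_const _).congr_deriv (by norm_num; ring)

theorem colorInd_false_add_true (k : Bool) : colorInd k false + colorInd k true = 1 := by
  cases k <;> simp [colorInd]

variable {M sP sQ : ℕ} {sPF sQF : Fin M → ℕ} {S : PMGARK M sP sQ sPF sQF} {r : ℕ}

/-- The coefficients of the slow and the fast potentials are indicators of the colours `a`, `b`,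
`c`, so the numerical solution sees exactly one colouring of each tree: `c` at the root of the trees
in `q 4`, `q 5`, `q 6`, then `a`, and `b` at the second leaf or the top. The indicators of a colour
add up to `1` in the exact system, whose solution is therefore the same for all choices. -/
theorem HasOrder.isBigO_test (h : S.HasOrder r) (a b c : Bool) :
    (fun t => testQ t (∑ j, S.bar.flatWt j * colorInd b (color j))
      (∑ j, S.bar.flatWt j * colorInd c (color j) * ∑ i, S.til.flat j i * colorInd a (color i))
      (∑ j, S.bar.flatWt j * colorInd c (color j) *
        ((∑ i, S.til.flat j i * colorInd a (color i)) *
          ∑ i, S.til.flat j i * colorInd b (color i)))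
      (∑ j, S.bar.flatWt j * colorInd c (color j) *
        ∑ i, S.til.flat j i * colorInd a (color i) *
          ∑ m, S.bar.flat i m * colorInd b (color m)) - testQ t 1 (1 / 2) (1 / 3) (1 / 6))
      =O[𝓝[>] 0] fun t : ℝ => t ^ (r + 1) := by
  set A : Idx sP sPF → ℝ := fun j => ∑ i, S.til.flat j i * colorInd a (color i) with hA
  set A' : Idx sP sPF → ℝ := fun j => ∑ i, S.til.flat j i * colorInd b (color i) with hA'
  set U : Idx sQ sQF → ℝ := fun i => ∑ m, S.bar.flat i m * colorInd b (color m) with hU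
  set D : Idx sP sPF → ℝ := fun j => ∑ i, S.til.flat j i * colorInd a (color i) * U i with hD
  set P : ℝ → Idx sP sPF → EuclideanSpace ℝ (Fin 7) := fun t j => testP t (A j) (A' j) (D j) with hP
  set Q : ℝ → Idx sQ sQF → EuclideanSpace ℝ (Fin 7) := fun t i =>
    testQ t (U i) (∑ j, S.bar.flat i j * colorInd c (color j) * A j)
      (∑ j, S.bar.flat i j * colorInd c (color j) * (A j * A' j))
      (∑ j, S.bar.flat i j * colorInd c (color j) * D j) with hQ
  have hV : ∀ k, cond k (testV (colorInd a true) (colorInd b true))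
      (testV (colorInd a false) (colorInd b false)) = testV (colorInd a k) (colorInd b k) := by
    rintro (_ | _) <;> rfl
  have hT : ∀ k, cond k (testT (colorInd b true) (colorInd c true))
      (testT (colorInd b false) (colorInd c false)) = testT (colorInd b k) (colorInd c k) := by
    rintro (_ | _) <;> rfl
  have hjP : ∀ t, join (fun i => P t (.inl i)) (fun k i => P t (.inr ⟨k, i⟩)) = P t := fun t => by
    ext1 (x | x) <;> rfl
  have hjQ : ∀ t, join (fun i => Q t (.inl i)) (fun k i => Q t (.inr ⟨k, i⟩)) = Q t := fun t => by
    ext1 (x | x) <;> rfl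
  have hp0 : ∀ A A' D, testP 0 A A' D = 0 := fun A A' D => by
    ext i
    fin_cases i <;> simp [testP]
  have hq0 : ∀ U X Y Z, testQ 0 U X Y Z = 0 := fun U X Y Z => by
    ext i
    fin_cases i <;> simp [testQ]
  have hcP : ∀ j, Tendsto (fun t => P t j) (𝓝[>] 0) (𝓝 (testP 0 1 1 (1 / 2))) := fun j => by
    -- At `t = 0` the value does not depend on the weights, so the weights in the limit may be
    -- replaced by those of the stage.
    rw [hp0, ← hp0]
    exact ((continuous_testP _ _ _).tendsto 0).mono_left nhdsWithin_le_nhds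
  have hcQ : ∀ j, Tendsto (fun t => Q t j) (𝓝[>] 0)
      (𝓝 (testQ 0 1 (1 / 2) (1 / 3) (1 / 6))) := fun j => by
    rw [hq0, ← hq0]
    exact ((continuous_testQ _ _ _ _).tendsto 0).mono_left nhdsWithin_le_nhds
  have key := (h 7 (testT (colorInd b false) (colorInd c false))
    (testT (colorInd b true) (colorInd c true)) (testV (colorInd a false) (colorInd b false))
    (testV (colorInd a true) (colorInd b true)) (contDiff_testT _ _) (contDiff_testT _ _)
    (contDiff_testV _ _) (contDiff_testV _ _) (fun t => testP t 1 1 (1 / 2))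
    (fun t => testQ t 1 (1 / 2) (1 / 3) (1 / 6)) ?_ ?_
    (fun t i => P t (.inl i)) (fun t k i => P t (.inr ⟨k, i⟩))
    (fun t i => Q t (.inl i)) (fun t k i => Q t (.inr ⟨k, i⟩)) ?_
    (fun i => hcP _) (fun k i => hcP _) (fun i => hcQ _) (fun k i => hcQ _)).2
  · refine key.congr_left fun t => ?_
    simp only [nextQ_eq, hT, hjP, hq0]
    rw [← testQ_eq_sum]
  · refine Eventually.of_forall fun t => (hasDerivAt_testP t).congr_deriv ?_
    rw [sub_eq_add_neg, neg_gradient_testV_testQ, neg_gradient_testV_testQ]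
    ext i
    fin_cases i <;> simp [colorInd_false_add_true, ← add_mul]
  · refine Eventually.of_forall fun t => (hasDerivAt_testQ t).congr_deriv ?_
    rw [gradient_testT_testP, gradient_testT_testP]
    ext i
    fin_cases i <;> simp [colorInd_false_add_true, ← add_mul, div_eq_mul_inv]
  · refine Eventually.of_forall fun t => (isStages_iff ..).2 ?_
    simp only [hV, hT, hjP, hjQ, hp0, hq0]
    exact ⟨fun x => testP_eq_sum .., fun x => testQ_eq_sum ..⟩

theorem isBigO_coord {n : ℕ} {l : Filter ℝ} {y : ℝ → EuclideanSpace ℝ (Fin n)} {g : ℝ → ℝ}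
    (h : y =O[l] g) (i : Fin n) : (fun t => y t i) =O[l] g :=
  ((EuclideanSpace.proj i : EuclideanSpace ℝ (Fin n) →L[ℝ] ℝ).isBigO_comp y l).trans h

/-- Coordinate `0` of the error is `t` times the defect of the condition; colours that do not occur
in the tree are set arbitrarily. Coordinates `4`, `5` and `6` serve the larger trees in the same
way. -/
theorem HasOrder.colorOne (h : S.HasOrder r) (hr : 1 ≤ r) : ColorOne S.bar.flatWt color := by
  intro b
  refine sub_eq_zero.1 (eq_zero_of_pow_mul_isBigO hr
    ((isBigO_coord (h.isBigO_test false b false) 0).congr_left fun t => ?_))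
  simp only [testQ, PiLp.sub_apply, Matrix.cons_val]
  ring

theorem HasOrder.colorTwo (h : S.HasOrder r) (hr : 2 ≤ r) :
    ColorTwo S.bar.flatWt S.til.flat color color := by
  intro c a
  refine sub_eq_zero.1 (eq_zero_of_pow_mul_isBigO hr
    ((isBigO_coord (h.isBigO_test a false c) 4).congr_left fun t => ?_))
  simp only [testQ, PiLp.sub_apply, Matrix.cons_val]
  ring

theorem HasOrder.colorBushy (h : S.HasOrder r) (hr : 3 ≤ r) :
    ColorBushy S.bar.flatWt S.til.flat color color := by
  intro c a b
  refine sub_eq_zero.1 (eq_zero_of_pow_mul_isBigO hr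
    ((isBigO_coord (h.isBigO_test a b c) 5).congr_left fun t => ?_))
  simp only [testQ, PiLp.sub_apply, Matrix.cons_val]
  ring

theorem HasOrder.colorTall (h : S.HasOrder r) (hr : 3 ≤ r) :
    ColorTall S.bar.flatWt S.bar.flat S.til.flat color color := by
  intro c a b
  refine sub_eq_zero.1 (eq_zero_of_pow_mul_isBigO hr
    ((isBigO_coord (h.isBigO_test a b c) 6).congr_left fun t => ?_))
  simp only [testQ, PiLp.sub_apply, Matrix.cons_val]
  ring

end TestSystem

/-! ### Characterization of the orders one to three -/

theorem hasOrder_one_iff {M sP sQ : ℕ} {sPF sQF : Fin M → ℕ} (hM : (M : ℝ) ≠ 0)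
    (S : PMGARK M sP sQ sPF sQF) : S.HasOrder 1 ↔ S.OrderOne := by
  simp only [OrderOne, ← colorOne_iff _ hM]
  refine ⟨fun h => ⟨h.colorOne le_rfl, h.swap.colorOne le_rfl⟩, fun h => ?_⟩
  refine hasOrder_of_errorBound S 1 ?_ ?_
  · exact fun d f g p q P Q hs => hs.isBigO_two h.1
  · exact fun d f g p q P Q hs => hs.isBigO_two h.2

theorem hasOrder_two_iff {M sP sQ : ℕ} {sPF sQF : Fin M → ℕ} (hM : (M : ℝ) ≠ 0)
    (S : PMGARK M sP sQ sPF sQF) : S.HasOrder 2 ↔ S.OrderOne ∧ S.OrderTwo := by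
  simp only [OrderOne, OrderTwo, ← colorOne_iff _ hM, ← colorTwo_iff _ _ hM]
  refine ⟨fun h => ⟨⟨h.colorOne one_le_two, h.swap.colorOne one_le_two⟩,
    ⟨h.colorTwo le_rfl, h.swap.colorTwo le_rfl⟩⟩, fun h => ?_⟩
  refine hasOrder_of_errorBound S 2 ?_ ?_
  · exact fun d f g p q P Q hs => hs.isBigO_three h.1.1 h.2.1
  · exact fun d f g p q P Q hs => hs.isBigO_three h.1.2 h.2.2

theorem hasOrder_three_iff {M sP sQ : ℕ} {sPF sQF : Fin M → ℕ} (hM : (M : ℝ) ≠ 0)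
    (S : PMGARK M sP sQ sPF sQF) :
    S.HasOrder 3 ↔ S.OrderOne ∧ S.OrderTwo ∧ S.OrderThree := by
  simp only [OrderOne, OrderTwo, OrderThree, ← colorOne_iff _ hM, ← colorTwo_iff _ _ hM,
    ← colorThree_iff _ _ hM]
  refine ⟨fun h => ⟨⟨h.colorOne (by norm_num), h.swap.colorOne (by norm_num)⟩,
    ⟨h.colorTwo (by norm_num), h.swap.colorTwo (by norm_num)⟩,
    ⟨⟨h.colorBushy le_rfl, h.colorTall le_rfl⟩, ⟨h.swap.colorBushy le_rfl,
      h.swap.colorTall le_rfl⟩⟩⟩, fun h => ?_⟩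
  refine hasOrder_of_errorBound S 3 ?_ ?_
  · exact fun d f g p q P Q hs => hs.isBigO_four h.1.1 h.2.1.1 h.2.2.1.1 h.2.2.1.2
  · exact fun d f g p q P Q hs => hs.isBigO_four h.1.2 h.2.1.2 h.2.2.2.1 h.2.2.2.2

end PMGARK

namespace MGARK

variable {M s : ℕ} {sF : Fin M → ℕ}

/-- An MGARK scheme as a partitioned scheme with two equal tableaux. -/
def toPartitioned (S : MGARK M s sF) : PMGARK M s s sF sF := ⟨S, S⟩

/-- The pair `(p, q)` is one unknown `y` with the slow and the fast Hamiltonian vector field as its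
two parts. With equal tableaux the stage equations for `P` and `Q` are the two components of those
for the pairs. -/
theorem HasOrder.toPartitioned {S : MGARK M s sF} {r : ℕ} (h : S.HasOrder r) :
    S.toPartitioned.HasOrder r := by
  intro d TS TF VS VF hTS hTF hVS hVF p q hp hq PS PF QS QF hst hPS hPF hQS hQF
  let E := EuclideanSpace ℝ (Fin d)
  have hrank : Module.finrank ℝ (EuclideanSpace ℝ (Fin (d + d))) = Module.finrank ℝ (E × E) := by
    simp [E]
  -- The order is defined on Euclidean spaces only, so `E × E` is replaced by one of dimension `d +
  -- d`; any linear isomorphism will do, since continuous linear maps preserve the error bounds.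
  let L : EuclideanSpace ℝ (Fin (d + d)) ≃L[ℝ] E × E := ContinuousLinearEquiv.ofFinrankEq hrank
  let f : (E → ℝ) → (E → ℝ) → EuclideanSpace ℝ (Fin (d + d)) → EuclideanSpace ℝ (Fin (d + d)) :=
    fun T V x => L.symm (-gradient V (L x).2, gradient T (L x).1)
  have hf : ∀ {T V : E → ℝ}, ContDiff ℝ ∞ T → ContDiff ℝ ∞ V → ContDiff ℝ ∞ (f T V) := by
    intro T V hT hV
    exact L.symm.contDiff.comp ((hV.gradient.neg.comp (contDiff_snd.comp L.contDiff)).prodMk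
      (hT.gradient.comp (contDiff_fst.comp L.contDiff)))
  have hpair : ∀ {P Q : ℝ → E}, Tendsto P (𝓝[>] 0) (𝓝 (p 0)) → Tendsto Q (𝓝[>] 0) (𝓝 (q 0)) →
      Tendsto (fun H => L.symm (P H, Q H)) (𝓝[>] 0) (𝓝 (L.symm (p 0, q 0))) := by
    intro P Q hP hQ
    exact (L.symm.continuous.tendsto _).comp (hP.prodMk_nhds hQ)
  have key := h (d + d) (f TS VS) (f TF VF) (hf hTS hVS) (hf hTF hVF) (fun t => L.symm (p t, q t))
    ?_ (fun H i => L.symm (PS H i, QS H i)) (fun H k i => L.symm (PF H k i, QF H k i)) ?_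
    (fun i => hpair (hPS i) (hQS i)) (fun k i => hpair (hPF k i) (hQF k i))
  · have hL := ((L : EuclideanSpace ℝ (Fin (d + d)) →L[ℝ] E × E).isBigO_comp _ _).trans key
    refine ⟨(isBigO_fst_prod.trans hL).congr_left fun H => ?_,
      (isBigO_snd_prod.trans hL).congr_left fun H => ?_⟩
    · simp [next, stepIncr, f, PMGARK.nextP, MGARK.toPartitioned, Prod.fst_sum]
    · simp [next, stepIncr, f, PMGARK.nextQ, MGARK.toPartitioned, Prod.snd_sum]
  · filter_upwards [hp, hq] with t hpt hqt
    refine (L.symm.toContinuousLinearMap.hasFDerivAt.comp_hasDerivAt t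
      (hpt.prodMk hqt)).congr_deriv ?_
    simp only [f, ContinuousLinearEquiv.apply_symm_apply, ContinuousLinearEquiv.coe_coe]
    rw [← map_add, Prod.mk_add_mk, sub_eq_add_neg]
  · filter_upwards [hst] with H hH
    refine ⟨fun i => ?_, fun k i => ?_⟩
    · apply L.injective
      have h1 := hH.1 i
      have h2 := hH.2.2.1 i
      ext1
      · simpa [slowIncr, f, Prod.fst_sum, MGARK.toPartitioned] using h1
      · simpa [slowIncr, f, Prod.snd_sum, MGARK.toPartitioned] using h2
    · apply L.injective
      have h1 := hH.2.1 k i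
      have h2 := hH.2.2.2 k i
      ext1
      · simpa [fastIncr, f, Prod.fst_sum, MGARK.toPartitioned] using h1
      · simpa [fastIncr, f, Prod.snd_sum, MGARK.toPartitioned] using h2

theorem hasOrder_one_iff (hM : (M : ℝ) ≠ 0) (S : MGARK M s sF) :
    S.HasOrder 1 ↔ MRTableau.OrderOne S := by
  refine ⟨fun h => ((PMGARK.hasOrder_one_iff hM _).1 h.toPartitioned).1, fun h => ?_⟩
  simp only [← colorOne_iff _ hM] at h
  exact hasOrder_of_isColoredStep S 1 fun d f y Y hs => hs.isBigO_two h

theorem hasOrder_two_iff (hM : (M : ℝ) ≠ 0) (S : MGARK M s sF) :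
    S.HasOrder 2 ↔ MRTableau.OrderOne S ∧ S.OrderTwo := by
  refine ⟨fun h => ?_, fun h => ?_⟩
  · obtain ⟨h1, h2⟩ := (PMGARK.hasOrder_two_iff hM _).1 h.toPartitioned
    exact ⟨h1.1, h2.1⟩
  · simp only [OrderTwo, ← colorOne_iff _ hM, ← colorTwo_iff _ _ hM] at h
    exact hasOrder_of_isColoredStep S 2 fun d f y Y hs => hs.isBigO_three h.1 h.2

theorem hasOrder_three_iff (hM : (M : ℝ) ≠ 0) (S : MGARK M s sF) :
    S.HasOrder 3 ↔ MRTableau.OrderOne S ∧ S.OrderTwo ∧ S.OrderThree := by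
  refine ⟨fun h => ?_, fun h => ?_⟩
  · obtain ⟨h1, h2, h3⟩ := (PMGARK.hasOrder_three_iff hM _).1 h.toPartitioned
    exact ⟨h1.1, h2.1, h3.1⟩
  · simp only [OrderTwo, OrderThree, ← colorOne_iff _ hM, ← colorTwo_iff _ _ hM,
      ← colorThree_iff _ _ hM] at h
    exact hasOrder_of_isColoredStep S 3 fun d f y Y hs =>
      hs.isBigO_four h.1 h.2.1 h.2.2.1 h.2.2.2

end MGARK

/-! ### Uniform micro-steps -/

theorem sum_fin_val_cast (M : ℕ) : ∑ k : Fin M, (k : ℝ) = M * (M - 1) / 2 := by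
  induction M with
  | zero => simp
  | succ n ih =>
    rw [Fin.sum_univ_castSucc]
    simp only [Fin.val_castSucc, ih, Fin.val_last]
    push_cast
    ring

theorem sum_fin_val_cast_sq (M : ℕ) :
    ∑ k : Fin M, (k : ℝ) ^ 2 = M * (M - 1) * (2 * M - 1) / 6 := by
  induction M with
  | zero => simp
  | succ n ih =>
    rw [Fin.sum_univ_castSucc]
    simp only [Fin.val_castSucc, ih, Fin.val_last]
    push_cast
    ring

namespace MRTableau

section Uniform

variable {M rS cS : ℕ} {rF cF : Fin M → ℕ} {B : MRTableau M rS cS rF cF}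
  {C : MRTableau M cS rS cF rF}

theorem eq_of_sum_eq_of_forall_eq (hM : (M : ℝ) ≠ 0) {x : Fin M → ℝ} (h : ∀ k l, x k = x l)
    {c : ℝ} (hx : ∑ k, x k = M * c) (k : Fin M) : x k = c := by
  rw [Finset.sum_congr rfl fun l _ => h l k, Finset.sum_const, Finset.card_univ, Fintype.card_fin,
    nsmul_eq_mul] at hx
  exact mul_left_cancel₀ hM hx

theorem UniformWt.eq_one (hM : (M : ℝ) ≠ 0) (hu : B.UniformWt) (h1 : B.OrderOne) (k : Fin M) :
    B.bf k ⬝ᵥ 1 = 1 :=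
  eq_of_sum_eq_of_forall_eq (x := fun k => B.bf k ⬝ᵥ 1) hM hu (by rw [h1.fast, mul_one]) k

theorem UniformWt.wtBefore_eq (hM : (M : ℝ) ≠ 0) (hu : B.UniformWt) (h1 : B.OrderOne)
    (k : Fin M) : B.wtBefore k = k := by
  simp [wtBefore, wt, hu.eq_one hM h1]

theorem UniformWt.wtAfter_eq (hM : (M : ℝ) ≠ 0) (hu : B.UniformWt) (h1 : B.OrderOne)
    (k : Fin M) : B.wtAfter k = M - 1 - k := by
  have h2 : (Finset.Ioi k).card + 1 + k = M := by
    rw [Fin.card_Ioi]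
    omega
  have h3 : ((Finset.Ioi k).card : ℝ) + 1 + k = M := by exact_mod_cast h2
  simp only [wtAfter, wt, hu.eq_one hM h1, Finset.sum_const, nsmul_eq_mul, mul_one]
  linarith

/-- The weights of the earlier micro-steps contribute `0 + 1 + ... + (M - 1)`, and `M ^ 2 / 2 - M *
(M - 1) / 2 = M / 2`. -/
theorem fastTwo_iff_uniform (hM : (M : ℝ) ≠ 0) (hB : B.UniformWt) (hB1 : B.OrderOne)
    (hC : C.UniformWt) (hC1 : C.OrderOne) : B.FastTwo C ↔ B.FastTwoUniform C := by
  have e : ∑ k, B.bf k ⬝ᵥ (C.Aff k *ᵥ 1 + C.wtBefore k • 1)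
      = ∑ k, B.bf k ⬝ᵥ (C.Aff k *ᵥ 1) + M * (M - 1) / 2 := by
    simp only [dotProduct_add, dotProduct_smul, hB.eq_one hM hB1, hC.wtBefore_eq hM hC1,
      Finset.sum_add_distrib, smul_eq_mul, mul_one, sum_fin_val_cast]
  constructor
  · rintro ⟨h1, h2⟩
    rw [e] at h1
    exact ⟨by linarith, h2⟩
  · rintro ⟨h1, h2⟩
    refine ⟨?_, h2⟩
    rw [e, h1]
    ring

theorem slowThree_iff_uniform (hM : (M : ℝ) ≠ 0) (hB : B.UniformWt) (hB1 : B.OrderOne) :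
    B.SlowThree C ↔ B.SlowThreeUniform C := by
  constructor
  · rintro ⟨h1, h2, h3, h4, h5, h6, h7⟩
    simp only [hB.wtBefore_eq hM hB1] at h7
    exact ⟨h1, h2, h3, h4, h5, h6, h7⟩
  · rintro ⟨h1, h2, h3, h4, h5, h6, h7⟩
    simp only [← hB.wtBefore_eq hM hB1] at h7
    exact ⟨h1, h2, h3, h4, h5, h6, h7⟩

theorem dotProduct_diagonal_add_smul_one {n : ℕ} (b x : Fin n → ℝ) (c : ℝ) :
    b ⬝ᵥ (Matrix.diagonal (x + c • 1) *ᵥ (x + c • 1))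
      = b ⬝ᵥ (Matrix.diagonal x *ᵥ x) + 2 * c * (b ⬝ᵥ x) + c ^ 2 * (b ⬝ᵥ 1) := by
  simp only [dotProduct, Matrix.mulVec_diagonal, Finset.mul_sum, ← Finset.sum_add_distrib,
    Pi.add_apply, Pi.smul_apply, Pi.one_apply, smul_eq_mul]
  exact Finset.sum_congr rfl fun j _ => by ring

theorem diagonal_add_smul_one_mulVec {n : ℕ} (x y : Fin n → ℝ) (c : ℝ) :
    Matrix.diagonal (x + c • 1) *ᵥ y = (Matrix.diagonal x + c • 1) *ᵥ y := by
  ext j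
  simp [Matrix.add_mulVec, Matrix.smul_mulVec, Matrix.mulVec_diagonal, add_mul]

theorem UniformTwo.eq_half (hM : (M : ℝ) ≠ 0) (hu : B.UniformTwo C) (h2 : B.FastTwoUniform C)
    (k : Fin M) : B.bf k ⬝ᵥ (C.Aff k *ᵥ 1) = 1 / 2 :=
  eq_of_sum_eq_of_forall_eq (x := fun k => B.bf k ⬝ᵥ (C.Aff k *ᵥ 1)) hM hu
    (by rw [h2.ff]; ring) k

theorem fastThree_iff_uniform (hM : (M : ℝ) ≠ 0) (hB : B.UniformWt) (hB1 : B.OrderOne)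
    (hC : C.UniformWt) (hC1 : C.OrderOne) (hBC : B.UniformTwo C) (hCB : C.UniformTwo B)
    (hBC2 : B.FastTwoUniform C) (hCB2 : C.FastTwoUniform B) :
    B.FastThree C ↔ B.FastThreeUniform C := by
  -- Expanding the square with `σ = k`, weight sum `1` and second-order sum `1/2` leaves the
  -- correction `∑ (k + k ^ 2) = (M ^ 3 - M) / 3`.
  have e1 : ∑ k, B.bf k ⬝ᵥ (Matrix.diagonal (C.Aff k *ᵥ 1 + C.wtBefore k • 1)
        *ᵥ (C.Aff k *ᵥ 1 + C.wtBefore k • 1))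
      = ∑ k, B.bf k ⬝ᵥ (Matrix.diagonal (C.Aff k *ᵥ 1) *ᵥ (C.Aff k *ᵥ 1))
        + ((M : ℝ) ^ 3 / 3 - M / 3) := by
    simp only [dotProduct_diagonal_add_smul_one, hB.eq_one hM hB1, hC.wtBefore_eq hM hC1,
      hBC.eq_half hM hBC2, Finset.sum_add_distrib, ← Finset.sum_mul, ← Finset.mul_sum,
      sum_fin_val_cast, sum_fin_val_cast_sq]
    ring
  have e2 : ∑ k, (B.bf k ⬝ᵥ (C.Aff k *ᵥ (B.Aff k *ᵥ 1 + B.wtBefore k • 1))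
        + B.wtAfter k * (C.bf k ⬝ᵥ (B.Aff k *ᵥ 1 + B.wtBefore k • 1)))
      = ∑ k, B.bf k ⬝ᵥ (C.Aff k *ᵥ (B.Aff k *ᵥ 1)) + ((M : ℝ) ^ 3 / 6 - M / 6) := by
    -- The correction in micro-step `k` is `k / 2 + (M - 1 - k) * (1 / 2 + k)`: the first term uses
    -- the second-order sum of `B` with `C`, the second that of `C` with `B`. Its sum over `k` is
    -- `(M ^ 3 - M) / 6`.
    have e : ∀ k : Fin M, B.bf k ⬝ᵥ (C.Aff k *ᵥ (B.Aff k *ᵥ 1 + B.wtBefore k • 1))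
        + B.wtAfter k * (C.bf k ⬝ᵥ (B.Aff k *ᵥ 1 + B.wtBefore k • 1))
        = B.bf k ⬝ᵥ (C.Aff k *ᵥ (B.Aff k *ᵥ 1)) + (M - 1) / 2 + (M - 1) * (k : ℝ)
          - (k : ℝ) ^ 2 := fun k => by
      simp only [Matrix.mulVec_add, Matrix.mulVec_smul, dotProduct_add, dotProduct_smul,
        hC.eq_one hM hC1, hB.wtBefore_eq hM hB1, hB.wtAfter_eq hM hB1, hBC.eq_half hM hBC2,
        hCB.eq_half hM hCB2, smul_eq_mul]
      ring
    simp only [e, Finset.sum_sub_distrib, Finset.sum_add_distrib, ← Finset.mul_sum,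
      sum_fin_val_cast, sum_fin_val_cast_sq, Finset.sum_const, Finset.card_univ, Fintype.card_fin,
      nsmul_eq_mul]
    ring
  constructor
  · rintro ⟨h1, h2, h3, h4, h5, h6, h7⟩
    rw [e1] at h1
    rw [e2] at h4
    simp only [diagonal_add_smul_one_mulVec, hC.wtBefore_eq hM hC1] at h2
    exact ⟨by linarith, h2, h3, by linarith, h5, h6, h7⟩
  · rintro ⟨h1, h2, h3, h4, h5, h6, h7⟩
    simp only [← diagonal_add_smul_one_mulVec, ← hC.wtBefore_eq hM hC1] at h2
    refine ⟨?_, h2, h3, ?_, h5, h6, h7⟩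
    · rw [e1, h1]
      ring
    · rw [e2, h4]
      ring

end Uniform

/-! ### Symmetric tableaux -/

section Symmetric

variable {M rS cS : ℕ} {rF cF : Fin M → ℕ} {B : MRTableau M rS cS rF cF}
  {C : MRTableau M cS rS cF rF}

theorem mulVec_one_apply {m n : ℕ} (A : Matrix (Fin m) (Fin n) ℝ) (i : Fin m) :
    (A *ᵥ 1) i = ∑ j, A i j := by
  simp [Matrix.mulVec, dotProduct]

theorem sum_rev {n : ℕ} (g : Fin n → ℝ) : ∑ i : Fin n, g i.rev = ∑ i, g i :=
  Equiv.sum_comp Fin.revPerm g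

theorem sum_cast_rev {m n : ℕ} (h : m = n) (g : Fin n → ℝ) :
    ∑ i : Fin m, g (Fin.cast h i.rev) = ∑ i, g i :=
  Equiv.sum_comp (Fin.revPerm.trans (finCongr h)) g

theorem sum_sum_rev {nF : Fin M → ℕ} (h : ∀ k, nF k = nF k.rev) (g : ∀ k, Fin (nF k) → ℝ) :
    ∑ k : Fin M, ∑ i : Fin (nF k), g k.rev (Fin.cast (h k) i.rev) = ∑ k, ∑ i, g k i := by
  simp only [fun k => sum_cast_rev (h k) (g k.rev)]
  exact sum_rev fun k => ∑ i, g k i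

theorem IsSymmetric.wt_rev (h : B.IsSymmetric) (k : Fin M) : B.wt k.rev = B.wt k := by
  simp only [wt, dotProduct_one]
  rw [← sum_cast_rev (h.cols k) (B.bf k.rev)]
  exact Finset.sum_congr rfl fun j _ => h.bf k j

theorem IsSymmetric.wtBefore_rev (h : B.IsSymmetric) (k : Fin M) :
    B.wtBefore k.rev = B.wtAfter k := by
  simp only [wtBefore, wtAfter]
  refine Finset.sum_nbij' Fin.rev Fin.rev ?_ ?_ (by simp) (by simp) fun l _ => (h.wt_rev l).symm
  · intro l hl
    simpa [Fin.lt_rev_iff] using hl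
  · intro l hl
    simpa [Fin.lt_rev_iff] using hl

theorem wtBefore_add_wt_add_wtAfter (k : Fin M) :
    B.wtBefore k + B.wt k + B.wtAfter k = ∑ l, B.wt l := by
  have h1 : Finset.Iic k ∪ Finset.Ioi k = Finset.univ := by
    ext l
    simp [le_or_gt]
  rw [← h1, Finset.sum_union (by
    rw [Finset.disjoint_left]
    intro l hl hl'
    simp at hl hl'
    omega), ← Finset.Iio_insert, Finset.sum_insert (by simp)]
  simp only [wtBefore, wtAfter]
  ring

/-- Mirroring the stages leaves the weights fixed, so `x` may be replaced by its average with its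
mirror image, which is the constant `c / 2`. The next lemma is the same argument with the
micro-steps reversed as well. -/
theorem IsSymmetric.bs_dotProduct (h : B.IsSymmetric) {x : Fin cS → ℝ} {c : ℝ}
    (hx : ∀ j, x j + x j.rev = c) : B.bs ⬝ᵥ x = (B.bs ⬝ᵥ 1) * c / 2 := by
  have h1 : ∑ j, B.bs j * x j.rev = ∑ j, B.bs j * x j := by
    rw [← sum_rev fun j => B.bs j * x j]
    simp only [h.bs]
  have h2 : ∑ j, B.bs j * x j + ∑ j, B.bs j * x j.rev = ∑ j, B.bs j * c := by
    simp only [← Finset.sum_add_distrib, ← mul_add, hx]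
  simp only [dotProduct, Pi.one_apply, mul_one, Finset.sum_mul]
  linarith

theorem IsSymmetric.sum_bf_dotProduct (h : B.IsSymmetric) {x : ∀ k, Fin (cF k) → ℝ}
    {c : Fin M → ℝ} (hx : ∀ k j, x k j + x k.rev (Fin.cast (h.cols k) j.rev) = c k) :
    ∑ k, B.bf k ⬝ᵥ x k = (∑ k, B.wt k * c k) / 2 := by
  have h1 : ∑ k, ∑ j, B.bf k j * x k.rev (Fin.cast (h.cols k) j.rev)
      = ∑ k, ∑ j, B.bf k j * x k j := by
    rw [← sum_sum_rev h.cols fun k j => B.bf k j * x k j]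
    simp only [h.bf]
  have h2 : ∑ k, ∑ j, B.bf k j * x k j + ∑ k, ∑ j, B.bf k j * x k.rev (Fin.cast (h.cols k) j.rev)
      = ∑ k, ∑ j, B.bf k j * c k := by
    simp only [← Finset.sum_add_distrib, ← mul_add, hx]
  simp only [wt, dotProduct, Pi.one_apply, mul_one, Finset.sum_mul]
  linarith

/-- The row sums of a block at mirrored stages add up to the sum of the weights in that block, so by
order one the constants are `1` for the slow block and `M` for the fast blocks together. -/
theorem IsSymmetric.slowTwo (hB : B.IsSymmetric) (hC : C.IsSymmetric) (hB1 : B.OrderOne)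
    (hC1 : C.OrderOne) : B.SlowTwo C := by
  have hs := hC1.slow
  have hf := hC1.fast
  simp only [dotProduct_one] at hs hf
  constructor
  · rw [hB.bs_dotProduct (c := 1), hB1.slow, one_mul]
    intro j
    simp only [mulVec_one_apply]
    rw [← hs, ← sum_rev fun i => C.Ass j.rev i, ← Finset.sum_add_distrib]
    exact Finset.sum_congr rfl fun i _ => hC.Ass j i
  · rw [hB.bs_dotProduct (c := M), hB1.slow, one_mul]
    intro j
    simp only [Finset.sum_apply, mulVec_one_apply]
    rw [← hf, ← sum_sum_rev hC.cols fun k i => C.Asf k j.rev i]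
    simp only [← Finset.sum_add_distrib, hC.Asf]

theorem IsSymmetric.fastTwo (hB : B.IsSymmetric) (hC : C.IsSymmetric) (hB1 : B.OrderOne)
    (hC1 : C.OrderOne) : B.FastTwo C := by
  have hs := hC1.slow
  simp only [dotProduct_one] at hs
  have hBf : ∑ k, B.wt k = M := hB1.fast
  have hCf : ∑ k, C.wt k = M := hC1.fast
  constructor
  · rw [hB.sum_bf_dotProduct (c := fun _ => M), ← Finset.sum_mul, hBf, pow_two]
    intro k j
    -- At mirrored stages the row sums of the `Aff` blocks add up to `C.wt k`, and the offsets to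
    -- `C.wtBefore k + C.wtAfter k`; together these are all the weights, that is `M`.
    rw [← hCf, ← wtBefore_add_wt_add_wtAfter k, ← hC.wtBefore_rev]
    have h1 : (C.Aff k *ᵥ 1) j + (C.Aff k.rev *ᵥ 1) (Fin.cast (hB.cols k) j.rev) = C.wt k := by
      simp only [mulVec_one_apply, wt, dotProduct_one]
      rw [← sum_cast_rev (hC.cols k) fun i => C.Aff k.rev (Fin.cast (hB.cols k) j.rev) i,
        ← Finset.sum_add_distrib]
      exact Finset.sum_congr rfl fun i _ => hC.Aff k j i
    simp only [Pi.add_apply, Pi.smul_apply, Pi.one_apply, smul_eq_mul, mul_one]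
    linarith
  · rw [hB.sum_bf_dotProduct (c := fun _ => 1)]
    · simp only [mul_one, hBf]
    intro k j
    simp only [mulVec_one_apply]
    rw [← hs, ← sum_rev fun i => C.Afs k.rev (Fin.cast (hB.cols k) j.rev) i,
      ← Finset.sum_add_distrib]
    exact Finset.sum_congr rfl fun i _ => hC.Afs k j i

end Symmetric

end MRTableau

theorem mainTheorem2 (M : ℕ) (hM : 1 ≤ M) :
    -- MGARK schemes for general additively partitioned systems
    (∀ (s : ℕ) (sF : Fin M → ℕ) (S : MGARK M s sF),
      (MGARK.HasOrder S 1 ↔ MRTableau.OrderOne S) ∧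
      (MGARK.HasOrder S 2 ↔ MRTableau.OrderOne S ∧ MGARK.OrderTwo S) ∧
      (MGARK.HasOrder S 3 ↔
        MRTableau.OrderOne S ∧ MGARK.OrderTwo S ∧ MGARK.OrderThree S) ∧
      (MRTableau.UniformWt S →
        (MGARK.HasOrder S 2 ↔ MRTableau.OrderOne S ∧ MGARK.OrderTwoUniform S) ∧
        (MRTableau.UniformTwo S S →
          (MGARK.HasOrder S 3 ↔
            MRTableau.OrderOne S ∧ MGARK.OrderTwoUniform S ∧ MGARK.OrderThreeUniform S))) ∧
      (MRTableau.IsSymmetric S → MRTableau.OrderOne S →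
        MGARK.OrderTwo S ∧ (MRTableau.UniformWt S → MGARK.OrderTwoUniform S))) ∧
    -- partitioned MGARK schemes for separable Hamiltonian systems
    (∀ (sP sQ : ℕ) (sPF sQF : Fin M → ℕ) (S : PMGARK M sP sQ sPF sQF),
      (S.HasOrder 1 ↔ S.OrderOne) ∧
      (S.HasOrder 2 ↔ S.OrderOne ∧ S.OrderTwo) ∧
      (S.HasOrder 3 ↔ S.OrderOne ∧ S.OrderTwo ∧ S.OrderThree) ∧
      (S.UniformWt →
        (S.HasOrder 2 ↔ S.OrderOne ∧ S.OrderTwoUniform) ∧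
        (S.UniformTwo →
          (S.HasOrder 3 ↔ S.OrderOne ∧ S.OrderTwoUniform ∧ S.OrderThreeUniform))) ∧
      (S.IsSymmetric → S.OrderOne →
        S.OrderTwo ∧ (S.UniformWt → S.OrderTwoUniform))) := by
  have hM' : (M : ℝ) ≠ 0 := by exact_mod_cast (by omega : M ≠ 0)
  constructor
  · intro s sF S
    have two : UniformWt S → OrderOne S → (S.OrderTwo ↔ S.OrderTwoUniform) := fun hu h1 =>
      and_congr Iff.rfl (fastTwo_iff_uniform hM' hu h1 hu h1)
    refine ⟨S.hasOrder_one_iff hM', S.hasOrder_two_iff hM', S.hasOrder_three_iff hM',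
      fun hu => ⟨?_, fun hu2 => ?_⟩, fun hs h1 => ?_⟩
    · rw [S.hasOrder_two_iff hM']
      exact and_congr_right (two hu)
    · rw [S.hasOrder_three_iff hM']
      refine and_congr_right fun h1 => ?_
      rw [two hu h1]
      refine and_congr_right fun h2 => and_congr (slowThree_iff_uniform hM' hu h1) ?_
      exact fastThree_iff_uniform hM' hu h1 hu h1 hu2 hu2 h2.2 h2.2
    · have h2 : S.OrderTwo := ⟨hs.slowTwo hs h1 h1, hs.fastTwo hs h1 h1⟩
      exact ⟨h2, fun hu => (two hu h1).1 h2⟩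
  · intro sP sQ sPF sQF S
    have two : S.UniformWt → S.OrderOne → (S.OrderTwo ↔ S.OrderTwoUniform) := fun hu h1 =>
      and_congr (and_congr Iff.rfl (fastTwo_iff_uniform hM' hu.1 h1.1 hu.2 h1.2))
        (and_congr Iff.rfl (fastTwo_iff_uniform hM' hu.2 h1.2 hu.1 h1.1))
    refine ⟨S.hasOrder_one_iff hM', S.hasOrder_two_iff hM', S.hasOrder_three_iff hM',
      fun hu => ⟨?_, fun hu2 => ?_⟩, fun hs h1 => ?_⟩
    · rw [S.hasOrder_two_iff hM']
      exact and_congr_right (two hu)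
    · rw [S.hasOrder_three_iff hM']
      refine and_congr_right fun h1 => ?_
      rw [two hu h1]
      refine and_congr_right fun h2 => and_congr
        (and_congr (slowThree_iff_uniform hM' hu.1 h1.1) ?_)
        (and_congr (slowThree_iff_uniform hM' hu.2 h1.2) ?_)
      · exact fastThree_iff_uniform hM' hu.1 h1.1 hu.2 h1.2 hu2.1 hu2.2 h2.1.2 h2.2.2
      · exact fastThree_iff_uniform hM' hu.2 h1.2 hu.1 h1.1 hu2.2 hu2.1 h2.2.2 h2.1.2
    · have h2 : S.OrderTwo :=
        ⟨⟨hs.1.slowTwo hs.2 h1.1 h1.2, hs.1.fastTwo hs.2 h1.1 h1.2⟩,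
          ⟨hs.2.slowTwo hs.1 h1.2 h1.1, hs.2.fastTwo hs.1 h1.2 h1.1⟩⟩
      exact ⟨h2, fun hu => (two hu h1).1 h2⟩
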